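/- **Setting.** Let $d_1,d_2,N\ge 1$ be integers, $T\in\mathbb C\setminus\{0\}$, and $$V_1(x)=g_0+\sum_{k=1}^{d_1+1}\frac{g_k}{k}x^k,\qquad V_2(y)=\tilde g_0+\sum_{k=1}^{d_2+1}\frac{\tilde g_k}{k}y^k$$ complex polynomials with $g_{d_1+1}\ne0\ne\tilde g_{d_2+1}$. Let $\Gamma^x_1,\dots,\Gamma^x_{d_1}$ be homologically independent $C^1$ paths (zero velocity allowed) in $\mathbb C$, each starting at $\infty$ inside a closed subsector of one of the $d_1+1$ open sectors $\mathrm{Re}\,(g_{d_1+1}x^{d_1+1}/T)>0$ and ending at $\infty$ inside a closed subsector of another, with $\int_{\Gamma^x_i}e^{-\varepsilon|x|^{d_1+1}}|dx|<\infty$ for all $\varepsilon>0$; the homology class of a path is the formal difference (final sector) $-$ (initial sector). Let $\Gamma^y_1,\dots,\Gamma^y_{d_2}$ be analogous paths for $V_2$. Let $\kappa=(\kappa_{i,j})$ be a complex $d_1\times d_2$ matrix and $\int_\Gamma:=\sum_{i,j}\kappa_{i,j}\int_{\Gamma^x_i\times\Gamma^y_j}$. If $d_1=d_2=1$, suppose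 in addition that all integrals $\int_{\Gamma^x_i\times\Gamma^y_j}x^ay^be^{-\frac NT[V_1(x)+V_2(y)-xy]}dx\,dy$, $a,b\ge0$, converge absolutely (otherwise this is automatic). Suppose that there are monic polynomials $\pi_n,\sigma_n$ of degree $n$ and numbers $h_n\neq0$ ($n\ge 0$) with $$\int_\Gamma \pi_n(x)\sigma_m(y)\,e^{-\frac NT[V_1(x)+V_2(y)-xy]}\,dx\,dy=h_n\delta_{nm},$$ and choose square roots $\sqrt{h_n}$. Define semi-infinite matrices by $x\frac{\pi_n}{\sqrt{h_n}}=\sum_mQ_{nm}\frac{\pi_m}{\sqrt{h_m}}$ and $y\frac{\sigma_n}{\sqrt{h_n}}=\sum_mP_{nm}\frac{\sigma_m}{\sqrt{h_m}}$. Put $\phi_n(y)=\frac{\sigma_n(y)}{\sqrt{h_n}}e^{-\frac NTV_2(y)}$, $$\tilde\phi^{(0)}_n(x)=e^{\frac NTV_1(x)}\int_\Gamma\frac{\phi_n(y)}{x-x'}e^{-\frac NTV_1(x')}e^{\frac NTx'y}\,dx'\,dy\quad\Big(x\in\Omega:=\mathbb C\setminus\bigcup_i\Gamma^x_i\Big),$$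 $$\tilde\phi^{(k)}_n(x)=\int_{\Gamma^y_k}\phi_n(y)e^{\frac NTxy}\,dy\quad(x\in\mathbb C,\ k=1,\dots,d_2),$$ and $\tilde\Phi^{(k)}_n=(\tilde\phi^{(k)}_{n-1},\dots,\tilde\phi^{(k)}_{n+d_2-1})^t$. For $n\ge1$ let $\tilde F_n(x)$ be the matrix of polynomials, with rows $m\ge0$ and columns $n-1\le j\le n+d_2-1$, whose rows $n-1,\dots,n+d_2-1$ form the identity matrix and whose other rows are determined by the recursion $x\,\tilde F_{m}=\sum_{l=m-1}^{m+d_2}Q_{l,m}\tilde F_{l}$ ($m\ge1$), solved downwards and upwards from the window. Let $\tilde{\mathcal D}_{1,n}(x)$ be the $(d_2+1)\times(d_2+1)$ matrix formed by the rows $n-1,\dots,n+d_2-1$ of $P\tilde F_n(x)$; its entries are polynomials in $x$. **Theorem.** Let $n>d_1$, and let $\tilde{\mathbf\Phi}_n(x)$ be the $(d_2+1)\times(d_2+1)$ matrix with columns $\tilde\Phi^{(k)}_n(x)$, $k=0,\dots,d_2$. Then $\tilde{\mathbf\Phi}_n$ is a fundamental solution on $\Omega$ of $$\frac TN\,\partial_x\tilde{\mathbf\Phi}_n(x)=\tilde{\mathcal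 D}_{1,n}(x)\,\tilde{\mathbf\Phi}_n(x),$$ that is, it is differentiable, satisfies this equation and is invertible at every $x\in\Omega$. There is a constant $C\ne0$, the same on all of $\Omega$, such that for all $x\in\Omega$ $$\det\tilde{\mathbf\Phi}_n(x)=C\exp\Big(\frac NT\Big(V_1(x)-\frac{\tilde g_{d_2}}{\tilde g_{d_2+1}}x+\delta_{d_2,1}\frac{x^2}{2\tilde g_2}\Big)\Big).$$ Moreover, for each connected component $A$ of $\Omega$ there is an entire vector function which coincides with $\tilde\Phi_n^{(0)}$ on $A$ and such that, when it replaces the column $\tilde\Phi_n^{(0)}$, the resulting matrix is a fundamental solution of the same system on all of $\mathbb C$ and its determinant is given by the same formula, with the same $C$, for all $x\in\mathbb C$. -/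

import Mathlib

open Polynomial

namespace TwoMatrix

noncomputable section

/-- The potential `V(z) = g₀ + ∑_{k=1}^{d+1} (g_k / k) z^k`. -/
def potential (d : ℕ) (g : ℕ → ℂ) : ℂ[X] :=
  C (g 0) + ∑ k ∈ Finset.Icc 1 (d + 1), C (g k / k) * X ^ k

/-- An oriented path in `ℂ` from infinity to infinity along which `exp (-c V)` decays, where `V` is
a polynomial of degree `d + 1` with leading coefficient `lead / (d + 1)`.
The set `{z | 0 < Re (c * lead * z ^ (d + 1))}` is the disjoint union of `d + 1` open sectors with
apex `0` and opening angle `π / (d + 1)`; each of them is named by the complex number `u` on its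
bisecting ray with `c * lead * u ^ (d + 1) = 1`.  The path starts at infinity within (a closed
subsector of) one of these sectors and ends at infinity within (a closed subsector of) another one.
It is continuously differentiable, possibly with vanishing velocity (so that corners and
self-intersections are allowed). The last field says that it is not so long that the integrals
against the exponentially decaying weight could diverge. -/
structure Contour (c lead : ℂ) (d : ℕ) where
  /-- the parametrization -/
  path : ℝ → ℂ
  contDiff : ContDiff ℝ 1 path
  /-- the sector where the path starts -/
  source : ℂ
  /-- the sector where the path ends -/
  target : ℂ
  source_spec : c * lead * source ^ (d + 1) = 1
  target_spec : c * lead * target ^ (d + 1) = 1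
  tendsto_source : Filter.Tendsto (fun t => ‖path t‖) Filter.atBot Filter.atTop
  tendsto_target : Filter.Tendsto (fun t => ‖path t‖) Filter.atTop Filter.atTop
  sector_source : ∃ θ : ℝ, θ < Real.pi / (2 * (d + 1)) ∧
    ∀ᶠ t in Filter.atBot, |Complex.arg (path t / source)| ≤ θ
  sector_target : ∃ θ : ℝ, θ < Real.pi / (2 * (d + 1)) ∧
    ∀ᶠ t in Filter.atTop, |Complex.arg (path t / target)| ≤ θ
  tame : ∀ ε : ℝ, 0 < ε →
    MeasureTheory.Integrable (fun t => ‖deriv path t‖ * Real.exp (-ε * ‖path t‖ ^ (d + 1)))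

/-- The homology class of a contour, relative to the union of the `d + 1` sectors near infinity.
As the plane is contractible, the boundary map identifies relative homology classes of paths with
`0`-chains of sectors, so the class is `[target] - [source]`. -/
def Contour.homologyClass {c lead : ℂ} {d : ℕ} (γ : Contour c lead d) : ℂ →₀ ℤ :=
  Finsupp.single γ.target 1 - Finsupp.single γ.source 1

/-- The integral `∫_γ f(z) dz`. -/
def Contour.integral {c lead : ℂ} {d : ℕ} (γ : Contour c lead d) (f : ℂ → ℂ) : ℂ :=
  ∫ t : ℝ, f (γ.path t) * deriv γ.path t

/-- The integral `∫_Γ f(x, y) dx dy` over `Γ = ∑_{i,j} κ_{i,j} Γˣ_i × Γʸ_j`. -/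
def doubleIntegral {c lead₁ lead₂ : ℂ} {d₁ d₂ : ℕ} (Γx : Fin d₁ → Contour c lead₁ d₁)
    (Γy : Fin d₂ → Contour c lead₂ d₂) (κ : Matrix (Fin d₁) (Fin d₂) ℂ) (f : ℂ → ℂ → ℂ) : ℂ :=
  ∑ i, ∑ j, κ i j * ∫ p : ℝ × ℝ, f ((Γx i).path p.1) ((Γy j).path p.2) *
    (deriv (Γx i).path p.1 * deriv (Γy j).path p.2)

/-- All mixed moments of `exp (-c (V₁(x) + V₂(y) - x y)) dx dy` on the products `Γˣ_i × Γʸ_j`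
converge absolutely. -/
def MomentsConverge {c lead₁ lead₂ : ℂ} {d₁ d₂ : ℕ} (V₁ V₂ : ℂ[X])
    (Γx : Fin d₁ → Contour c lead₁ d₁) (Γy : Fin d₂ → Contour c lead₂ d₂) : Prop :=
  ∀ i j (a b : ℕ), MeasureTheory.Integrable fun p : ℝ × ℝ =>
    (Γx i).path p.1 ^ a * (Γy j).path p.2 ^ b *
      Complex.exp (-c * (V₁.eval ((Γx i).path p.1) + V₂.eval ((Γy j).path p.2) -
        (Γx i).path p.1 * (Γy j).path p.2)) *
      (deriv (Γx i).path p.1 * deriv (Γy j).path p.2)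

/-- `∫_Γ π_n(x) σ_m(y) exp (-c (V₁(x) + V₂(y) - x y)) dx dy = h_n δ_{n,m}`, with `π_n` and `σ_n`
monic of degree `n`. -/
def IsBiorthogonal {c lead₁ lead₂ : ℂ} {d₁ d₂ : ℕ} (V₁ V₂ : ℂ[X])
    (Γx : Fin d₁ → Contour c lead₁ d₁) (Γy : Fin d₂ → Contour c lead₂ d₂)
    (κ : Matrix (Fin d₁) (Fin d₂) ℂ) (π σ : Polynomial.Sequence ℂ) (h : ℕ → ℂ) : Prop :=
  (∀ n, (π n).Monic) ∧ (∀ n, (σ n).Monic) ∧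
  ∀ n m, doubleIntegral Γx Γy κ (fun x y => (π n).eval x * (σ m).eval y *
    Complex.exp (-c * (V₁.eval x + V₂.eval y - x * y))) = if n = m then h n else 0

/-- The semi-infinite matrix `M` of multiplication by the variable in the basis `p_n / r_n`:
`z p_n(z) / r_n = ∑_m M_{n,m} p_m(z) / r_m`.  For `p = π` this is `Q`, for `p = σ` it is `P`. -/
def multMatrix (p : Polynomial.Sequence ℂ) (r : ℕ → ℂ) (n m : ℕ) : ℂ :=
  r m / r n * (p.basis fun i => isUnit_iff_ne_zero.mpr
    (leadingCoeff_ne_zero.mpr (p.ne_zero i))).repr (X * p n) m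

/-- The wave function `φ_n(y) = σ_n(y) exp (-c V₂(y)) / r_n`, where `r_n` is a square root of
`h_n`. -/
def waveFun (c : ℂ) (V₂ : ℂ[X]) (σ : Polynomial.Sequence ℂ) (r : ℕ → ℂ) (n : ℕ) (y : ℂ) : ℂ :=
  (σ n).eval y / r n * Complex.exp (-c * V₂.eval y)

/-- The Fourier-Laplace transform `∫_γ φ_n(y) exp (c x y) dy`. -/
def fourier {c lead₂ : ℂ} {d₂ : ℕ} (γ : Contour c lead₂ d₂) (V₂ : ℂ[X])
    (σ : Polynomial.Sequence ℂ) (r : ℕ → ℂ) (n : ℕ) (x : ℂ) : ℂ :=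
  γ.integral fun y => waveFun c V₂ σ r n y * Complex.exp (c * x * y)

/-- The Hilbert transform
`exp (c V₁(x)) ∫_Γ φ_n(y) / (x - x') exp (-c V₁(x')) exp (c x' y) dx' dy`. -/
def hilbert {c lead₁ lead₂ : ℂ} {d₁ d₂ : ℕ} (Γx : Fin d₁ → Contour c lead₁ d₁)
    (Γy : Fin d₂ → Contour c lead₂ d₂) (κ : Matrix (Fin d₁) (Fin d₂) ℂ) (V₁ V₂ : ℂ[X])
    (σ : Polynomial.Sequence ℂ) (r : ℕ → ℂ) (n : ℕ) (x : ℂ) : ℂ :=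
  Complex.exp (c * V₁.eval x) * doubleIntegral Γx Γy κ fun x' y =>
    waveFun c V₂ σ r n y / (x - x') * Complex.exp (-c * V₁.eval x') * Complex.exp (c * x' * y)

/-- The matrix whose columns `k = 0, …, d₂` are the dual windows
`(φ̃_{n-1}^{(k)}(x), …, φ̃_{n+d₂-1}^{(k)}(x))ᵗ`: the Hilbert transforms for `k = 0` and the
Fourier-Laplace transforms along the `k`-th contour for `k ≥ 1`. -/
def dualWindow {c lead₁ lead₂ : ℂ} {d₁ d₂ : ℕ} (Γx : Fin d₁ → Contour c lead₁ d₁)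
    (Γy : Fin d₂ → Contour c lead₂ d₂) (κ : Matrix (Fin d₁) (Fin d₂) ℂ) (V₁ V₂ : ℂ[X])
    (σ : Polynomial.Sequence ℂ) (r : ℕ → ℂ) (n : ℕ) (x : ℂ) :
    Matrix (Fin (d₂ + 1)) (Fin (d₂ + 1)) ℂ :=
  Matrix.of fun i => Fin.cons (hilbert Γx Γy κ V₁ V₂ σ r (n - 1 + i) x)
    fun k => fourier (Γy k) V₂ σ r (n - 1 + i) x

/-- Folding onto the dual window. The row `l` holds the coefficients, polynomial in `x`, which
express `f_l` through `f_s, …, f_{s+d}`, where `s` is the first index of the window,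
by means of the recursion relations `x f_m = ∑_{l = m-1}^{m+d} Q_{l,m} f_l`, `m ≥ 1`.
Below the window the relation with `m = l + 1` is solved for `f_l`, above the window the
relation with `m = l - d` is. -/
def dualFolding (d : ℕ) (Q : ℕ → ℕ → ℂ) (s : ℕ) (l : ℕ) : Fin (d + 1) → ℂ[X] :=
  if l < s then
    (Q l (l + 1))⁻¹ • ((X : ℂ[X]) • dualFolding d Q s (l + 1) -
      ∑ i : Fin (d + 1), Q (l + 1 + i) (l + 1) • dualFolding d Q s (l + 1 + i))
  else if 0 < d ∧ s + d < l then
    (Q l (l - d))⁻¹ • ((X : ℂ[X]) • dualFolding d Q s (l - d) -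
      ∑ i : Fin (d + 1), Q (l - d - 1 + i) (l - d) • dualFolding d Q s (l - d - 1 + i))
  else Pi.single (Fin.ofNat (d + 1) (l - s)) 1
termination_by if l < s then s - l else if s + d < l then l else 0
decreasing_by
  all_goals (try have hi := i.isLt); (split_ifs <;> omega)

/-- The matrix `D̃_{1,n}(x)`: the rows `n - 1, …, n + d₂ - 1` of the product of `P` and the
folding matrix. (As `P_{m,l} = 0` for `l > m + 1`, the product is a finite sum.) -/
def dualSystem (d₂ : ℕ) (P Q : ℕ → ℕ → ℂ) (n : ℕ) :
    Matrix (Fin (d₂ + 1)) (Fin (d₂ + 1)) ℂ[X] :=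
  Matrix.of fun i j => ∑ l ∈ Finset.range (n - 1 + i + 2),
    C (P (n - 1 + i) l) * dualFolding d₂ Q (n - 1) l j

/-- On the open set `U`, the matrix `Φ` is a fundamental solution of `ε Φ' = D Φ`. -/
def IsFundamentalSolution {ι : Type*} [Fintype ι] [DecidableEq ι] (ε : ℂ) (D : Matrix ι ι ℂ[X])
    (U : Set ℂ) (Φ : ℂ → Matrix ι ι ℂ) : Prop :=
  ∀ x ∈ U, (∀ i k, DifferentiableAt ℂ (fun z => Φ z i k) x ∧
    ε * deriv (fun z => Φ z i k) x = (D.map (Polynomial.eval x) * Φ x) i k) ∧ (Φ x).det ≠ 0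

end

end TwoMatrix

open TwoMatrix

namespace TwoMatrix

open Filter Topology MeasureTheory

/-! Write `c = N / T`. Each column of the dual window at `x` comes from a linear functional on
polynomials `q(y)`, evaluated at `σ_l / r_l`: the Fourier-Laplace transform along one contour, or
the Cauchy transform over `Γ` times `exp (c V₁(x))`. The resulting sequences `u_l` obey two laws.

Multiplication by `x`: by integration by parts in `y`, it amounts to replacing `q` by `V₂' q - c⁻¹
q'`. That operator is adjoint to multiplication by `x` in the bilinear pairing, so biorthogonality
identifies its matrix with the transpose of `Q`, and `x u_m = ∑ Q_{l,m} u_l`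
(`IsBiorthogonal.repr_string`, `columnSeq_recursion`). Only the Cauchy column has a defect, `exp (c
V₁(x)) r_0`, and only at `m = 0`.

Differentiation in `x`: it amounts to replacing `q` by `c y q`, so `u_m' = c ∑ P_{m,l} u_l`
(`hasDerivAt_columnSeq`). In the Cauchy column an error appears, the pairing of `σ_m` with the
divided difference of `V₁'`; this has degree less than `d₁` and is orthogonal to `σ_m` for `m ≥ d₁`,
whence the condition `n > d₁`. Folding by the first law (`eq_rowEval_dualFolding`) turns the second
into the differential system.

For the determinant, the first law relates consecutive windows by companion matrices whose
determinants are nonzero constants (`exists_det_windowMatrix_eq`). At the lowest window the defect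
splits off the Cauchy column and leaves the Wronskian of the Fourier-Laplace transforms
(`det_windowMatrix_zero`). That Wronskian satisfies a scalar first order equation on the whole
plane, and it is nonzero at `0` because homologically independent contours have independent moment
functionals (`eq_zero_of_sum_transform_eq_zero`). No differential equation is integrated over `Ω`,
which is why one constant serves all its components.

Finally, the system has polynomial coefficients. The solution with the value of the Cauchy column at
a point `x₀` is entire (`exists_entire_solution`) and agrees with that column on the component of
`x₀`; the determinant formula extends by the identity theorem. -/

/-! ### Growth of polynomials. -/

theorem exists_pow_le_mul_pow_add {d k : ℕ} (hk : k ≤ d) {ε : ℝ} (hε : 0 < ε) :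
    ∃ K : ℝ, ∀ r : ℝ, 0 ≤ r → r ^ k ≤ ε * r ^ (d + 1) + K := by
  -- Beyond this threshold `ε * r ^ (d + 1 - k) ≥ 1`; below it `M ^ k` bounds the left side.
  set M := max 1 (1 / ε) with hM
  have hM1 : 1 ≤ M := le_max_left _ _
  refine ⟨M ^ k, fun r hr => ?_⟩
  rcases le_total r M with h | h
  · have := pow_le_pow_left₀ hr h k
    have : 0 ≤ ε * r ^ (d + 1) := by positivity
    linarith
  · have h1 : M ≤ r ^ (d + 1 - k) :=
      h.trans (le_self_pow₀ (hM1.trans h) (by omega))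
    have h2 : r ^ (d + 1) = r ^ (d + 1 - k) * r ^ k := by
      rw [← pow_add]; congr 1; omega
    have h3 : 1 ≤ ε * M := by
      have : 1 / ε ≤ M := le_max_right _ _
      calc 1 = ε * (1 / ε) := by field_simp
        _ ≤ ε * M := by gcongr
    have h4 : 1 ≤ ε * r ^ (d + 1 - k) := h3.trans (by gcongr)
    have h5 : (0 : ℝ) ≤ r ^ k := by positivity
    have h6 : (0 : ℝ) ≤ M ^ k := by positivity
    rw [h2]
    nlinarith

theorem exists_norm_eval_le_mul_pow_add {d : ℕ} (p : ℂ[X]) (hp : p.natDegree ≤ d) {ε : ℝ}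
    (hε : 0 < ε) : ∃ K : ℝ, ∀ z : ℂ, ‖p.eval z‖ ≤ ε * ‖z‖ ^ (d + 1) + K := by
  have key : ∀ k ∈ Finset.range (d + 1), ∃ K : ℝ, ∀ z : ℂ,
      ‖p.coeff k * z ^ k‖ ≤ ε / (d + 1) * ‖z‖ ^ (d + 1) + K := by
    intro k hk
    obtain ⟨K, hK⟩ := exists_pow_le_mul_pow_add (d := d) (k := k)
      (by simpa [Nat.lt_succ_iff] using hk)
      (ε := ε / (d + 1) / (‖p.coeff k‖ + 1)) (by positivity)
    refine ⟨(‖p.coeff k‖ + 1) * K, fun z => ?_⟩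
    rw [norm_mul, norm_pow]
    calc ‖p.coeff k‖ * ‖z‖ ^ k ≤ (‖p.coeff k‖ + 1) * ‖z‖ ^ k := by gcongr; linarith
      _ ≤ (‖p.coeff k‖ + 1) * (ε / (d + 1) / (‖p.coeff k‖ + 1) * ‖z‖ ^ (d + 1) + K) := by
        gcongr; exact hK _ (norm_nonneg _)
      _ = _ := by field_simp
  choose! K hK using key
  refine ⟨∑ k ∈ Finset.range (d + 1), K k, fun z => ?_⟩
  rw [eval_eq_sum_range' (Nat.lt_succ_of_le hp)]
  refine (norm_sum_le _ _).trans ((Finset.sum_le_sum fun k hk => hK k hk z).trans ?_)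
  rw [Finset.sum_add_distrib, Finset.sum_const, Finset.card_range, nsmul_eq_mul]
  apply le_of_eq
  push_cast
  field_simp

/-- The polynomial is at most `r ^ m + K` with `m` above its degree, `r ^ m ≤ 1 + (r ^ (d + 1)) ^
m`, and the last power is controlled by a single term of the exponential series. -/
theorem exists_norm_eval_le_mul_exp (d : ℕ) (p : ℂ[X]) {ε : ℝ} (hε : 0 < ε) :
    ∃ A : ℝ, 0 ≤ A ∧ ∀ z : ℂ, ‖p.eval z‖ ≤ A * Real.exp (ε * ‖z‖ ^ (d + 1)) := by
  obtain ⟨K, hK⟩ := exists_norm_eval_le_mul_pow_add (d := p.natDegree) p le_rfl one_pos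
  set m := p.natDegree + 1
  have hK0 : 0 ≤ |K| := abs_nonneg K
  refine ⟨1 + m.factorial / ε ^ m + |K|, by positivity, fun z => ?_⟩
  set r := ‖z‖
  have hr : 0 ≤ r := norm_nonneg z
  have h1 : (ε * r ^ (d + 1)) ^ m / m.factorial ≤ Real.exp (ε * r ^ (d + 1)) :=
    Real.pow_div_factorial_le_exp _ (by positivity) _
  have h2 : 1 ≤ Real.exp (ε * r ^ (d + 1)) := Real.one_le_exp (by positivity)
  have h3 : r ^ m ≤ 1 + (r ^ (d + 1)) ^ m := by
    rcases le_total r 1 with h | h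
    · have := pow_le_one₀ (n := m) hr h
      have : 0 ≤ (r ^ (d + 1)) ^ m := by positivity
      linarith
    · have : r ^ m ≤ (r ^ (d + 1)) ^ m := by
        gcongr
        exact le_self_pow₀ h (by omega)
      linarith
  have h4 : (r ^ (d + 1)) ^ m ≤ m.factorial / ε ^ m * Real.exp (ε * r ^ (d + 1)) := by
    rw [div_le_iff₀ (by positivity), mul_pow] at h1
    rw [div_mul_eq_mul_div, le_div_iff₀ (by positivity)]
    linarith
  have h5 : K ≤ |K| * Real.exp (ε * r ^ (d + 1)) := by
    nlinarith [le_abs_self K]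
  have := hK z
  rw [one_mul] at this
  nlinarith

/-! ### Contours and the decay of the weight along them. -/

namespace Contour

variable {c lead : ℂ} {d : ℕ} (γ : Contour c lead d)

theorem continuous_path : Continuous γ.path := γ.contDiff.continuous

theorem continuous_deriv : Continuous (deriv γ.path) := γ.contDiff.continuous_deriv le_rfl

theorem hasDerivAt (t : ℝ) : HasDerivAt γ.path (deriv γ.path t) t :=
  (γ.contDiff.differentiable one_ne_zero t).hasDerivAt

/-- A path escaping to infinity at both ends is a proper map. This is what makes `Ω` open and keeps
its points at positive distance from the contours. -/
theorem isClosed_range : IsClosed (Set.range γ.path) := by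
  have hc : Tendsto γ.path (cocompact ℝ) (cocompact ℂ) := by
    rw [← Metric.cobounded_eq_cocompact (α := ℂ), ← comap_norm_atTop, tendsto_comap_iff,
      cocompact_eq_atBot_atTop]
    exact γ.tendsto_source.sup γ.tendsto_target
  exact (isProperMap_iff_tendsto_cocompact.mpr ⟨γ.continuous_path, hc⟩).isClosedMap.isClosed_range

/-- The condition that `V` is a polynomial with leading term `lead / (d + 1) X ^ (d + 1)`. -/
def _root_.TwoMatrix.HasLead (lead : ℂ) (d : ℕ) (V : ℂ[X]) : Prop :=
  (V - C (lead / (d + 1)) * X ^ (d + 1)).natDegree ≤ d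

/-- Lower bound for `Re (A z ^ (d + 1))` in a closed subsector. -/
theorem _root_.TwoMatrix.re_mul_pow_ge {A u z : ℂ} {d : ℕ} (hu : A * u ^ (d + 1) = 1) {θ : ℝ}
    (hθ : θ < Real.pi / (2 * (d + 1))) (hz : |Complex.arg (z / u)| ≤ θ) :
    Real.cos ((d + 1) * θ) * ‖z / u‖ ^ (d + 1) ≤ (A * z ^ (d + 1)).re := by
  have hu0 : u ≠ 0 := by
    rintro rfl
    simp at hu
  set w := z / u with hw
  have hz' : z = w * u := by rw [hw]; field_simp
  have h1 : A * z ^ (d + 1) = w ^ (d + 1) := by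
    rw [hz', mul_pow, mul_left_comm, hu, mul_one]
  have h2 : w ^ (d + 1) = ((‖w‖ ^ (d + 1) : ℝ) : ℂ) *
      Complex.exp (((d + 1 : ℝ) * w.arg : ℝ) * Complex.I) := by
    conv_lhs => rw [← Complex.norm_mul_exp_arg_mul_I w]
    rw [mul_pow, ← Complex.exp_nat_mul]
    push_cast
    ring_nf
  rw [h1, h2, Complex.re_ofReal_mul, Complex.exp_ofReal_mul_I_re, mul_comm]
  have hd : (0 : ℝ) < d + 1 := by positivity
  have h3 : (d + 1) * θ < Real.pi / 2 := by
    rw [lt_div_iff₀ (by positivity)] at hθ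
    linarith
  gcongr
  rw [← Real.cos_abs ((d + 1) * w.arg), abs_mul, abs_of_pos hd]
  apply Real.cos_le_cos_of_nonneg_of_le_pi (by positivity) (by linarith [Real.pi_pos])
  gcongr

theorem _root_.TwoMatrix.cos_pos_of_lt {d : ℕ} {θ : ℝ}
    (hθ : θ < Real.pi / (2 * (d + 1))) (hθ0 : 0 ≤ θ) : 0 < Real.cos ((d + 1) * θ) := by
  have h3 : (d + 1) * θ < Real.pi / 2 := by
    rw [lt_div_iff₀ (by positivity)] at hθ
    linarith
  apply Real.cos_pos_of_mem_Ioo ⟨by have := Real.pi_pos; nlinarith, h3⟩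

/-- In a closed subsector the leading term alone gives at least `η ‖z‖ ^ (d + 1)`; the terms of
degree at most `d` use up no more than half of it, apart from a constant. -/
theorem _root_.TwoMatrix.exists_le_re_of_sector {c lead u : ℂ} {d : ℕ}
    (hu : c * lead * u ^ (d + 1) = 1) {θ : ℝ} (hθ : θ < Real.pi / (2 * (d + 1))) (hθ0 : 0 ≤ θ)
    {V : ℂ[X]} (hV : HasLead lead d V) :
    ∃ δ > 0, ∃ K : ℝ, ∀ z : ℂ, |Complex.arg (z / u)| ≤ θ →
      δ * ‖z‖ ^ (d + 1) - K ≤ (c * V.eval z).re := by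
  have hu0 : u ≠ 0 := by
    rintro rfl
    simp at hu
  have hcos := cos_pos_of_lt hθ hθ0
  set η := Real.cos ((d + 1) * θ) / ‖u‖ ^ (d + 1) / (d + 1) with hη
  have hη0 : 0 < η := by positivity
  obtain ⟨K, hK⟩ := exists_norm_eval_le_mul_pow_add
    (C c * (V - C (lead / (d + 1)) * X ^ (d + 1))) (natDegree_C_mul_le _ _ |>.trans hV)
    (half_pos hη0)
  refine ⟨η / 2, by positivity, K, fun z hz => ?_⟩
  have h1 := re_mul_pow_ge hu hθ hz
  have h2 := hK z
  have h3 : c * V.eval z = (c * lead * z ^ (d + 1)) / ((d + 1 : ℝ) : ℂ) +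
      (C c * (V - C (lead / (d + 1)) * X ^ (d + 1))).eval z := by
    simp
    field_simp
    ring
  have h4 := (abs_le.mp (Complex.abs_re_le_norm
    ((C c * (V - C (lead / (d + 1)) * X ^ (d + 1))).eval z))).1
  rw [h3, Complex.add_re, Complex.div_ofReal_re]
  have h5 : η * ‖z‖ ^ (d + 1) ≤ (c * lead * z ^ (d + 1)).re / (d + 1) := by
    refine le_trans (le_of_eq ?_) (div_le_div_of_nonneg_right h1 (by positivity))
    rw [hη, norm_div, div_pow]
    field_simp
  linarith

/-- The two ends of the path lie in closed subsectors, and the stretch between them is compact. -/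
theorem exists_le_re {V : ℂ[X]} (hV : HasLead lead d V) :
    ∃ δ > 0, ∃ K : ℝ, ∀ t : ℝ, δ * ‖γ.path t‖ ^ (d + 1) - K ≤ (c * V.eval (γ.path t)).re := by
  obtain ⟨θ₁, hθ₁, hs₁⟩ := γ.sector_source
  obtain ⟨θ₂, hθ₂, hs₂⟩ := γ.sector_target
  have h01 : 0 ≤ θ₁ := by
    obtain ⟨t, ht⟩ := hs₁.exists
    exact (abs_nonneg _).trans ht
  have h02 : 0 ≤ θ₂ := by
    obtain ⟨t, ht⟩ := hs₂.exists
    exact (abs_nonneg _).trans ht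
  obtain ⟨δ₁, hδ₁, K₁, hK₁⟩ := exists_le_re_of_sector γ.source_spec hθ₁ h01 hV
  obtain ⟨δ₂, hδ₂, K₂, hK₂⟩ := exists_le_re_of_sector γ.target_spec hθ₂ h02 hV
  obtain ⟨a, ha⟩ := eventually_atBot.mp hs₁
  obtain ⟨b, hb⟩ := eventually_atTop.mp hs₂
  have hcont : Continuous fun t => min δ₁ δ₂ * ‖γ.path t‖ ^ (d + 1) -
      (c * V.eval (γ.path t)).re := by
    have := γ.continuous_path
    have h2 : Continuous fun t => V.eval (γ.path t) := V.continuous.comp this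
    fun_prop
  obtain ⟨K₃, hK₃⟩ := (isCompact_Icc (a := a) (b := b)).bddAbove_image hcont.continuousOn
  refine ⟨min δ₁ δ₂, lt_min hδ₁ hδ₂, max K₃ (max K₁ K₂), fun t => ?_⟩
  have hp : 0 ≤ ‖γ.path t‖ ^ (d + 1) := by positivity
  have hm1 := mul_le_mul_of_nonneg_right (min_le_left δ₁ δ₂) hp
  have hm2 := mul_le_mul_of_nonneg_right (min_le_right δ₁ δ₂) hp
  have hx1 := le_max_left K₃ (max K₁ K₂)
  have hx2 := le_max_right K₃ (max K₁ K₂)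
  have hx3 := le_max_left K₁ K₂
  have hx4 := le_max_right K₁ K₂
  by_cases h1 : t ≤ a
  · have := hK₁ _ (ha t h1)
    linarith
  by_cases h2 : b ≤ t
  · have := hK₂ _ (hb t h2)
    linarith
  · have := hK₃ (Set.mem_image_of_mem _ ⟨(not_le.mp h1).le, (not_le.mp h2).le⟩)
    linarith

/-- Along a contour, the weight beats polynomials and exponentials of polynomials of lower
degree. -/
theorem exists_norm_mul_exp_le {V : ℂ[X]} (hV : HasLead lead d V) (p l : ℂ[X])
    (hl : l.natDegree ≤ d) : ∃ δ > 0, ∃ A : ℝ, 0 ≤ A ∧ ∀ t : ℝ,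
      ‖p.eval (γ.path t)‖ * ‖Complex.exp (-c * V.eval (γ.path t))‖ *
        Real.exp ‖l.eval (γ.path t)‖ ≤ A * Real.exp (-δ * ‖γ.path t‖ ^ (d + 1)) := by
  obtain ⟨δ, hδ, K, hK⟩ := γ.exists_le_re hV
  obtain ⟨K', hK'⟩ := exists_norm_eval_le_mul_pow_add l hl (ε := δ / 4) (by positivity)
  obtain ⟨A, hA, hA'⟩ := exists_norm_eval_le_mul_exp d p (ε := δ / 4) (by positivity)
  refine ⟨δ / 2, by positivity, A * Real.exp (K + K'), by positivity, fun t => ?_⟩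
  set z := γ.path t with hz
  have h1 : ‖Complex.exp (-c * V.eval z)‖ ≤ Real.exp (K - δ * ‖z‖ ^ (d + 1)) := by
    rw [Complex.norm_exp]
    apply Real.exp_le_exp.mpr
    have := hK t
    rw [neg_mul, Complex.neg_re]
    linarith
  calc _ ≤ (A * Real.exp (δ / 4 * ‖z‖ ^ (d + 1))) * Real.exp (K - δ * ‖z‖ ^ (d + 1)) *
        Real.exp (δ / 4 * ‖z‖ ^ (d + 1) + K') := by
        gcongr
        · exact hA' z
        · exact hK' z
    _ = _ := by
      rw [mul_assoc, mul_assoc, mul_assoc, ← Real.exp_add, ← Real.exp_add, ← Real.exp_add]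
      congr 2
      ring

theorem integrable_of_norm_le {f : ℝ → ℂ} (hf : Continuous f) {δ A : ℝ} (hδ : 0 < δ)
    (h : ∀ t, ‖f t‖ ≤ A * Real.exp (-δ * ‖γ.path t‖ ^ (d + 1))) :
    Integrable fun t => f t * deriv γ.path t := by
  refine Integrable.mono' ((γ.tame δ hδ).const_mul A)
    ((hf.mul γ.continuous_deriv).aestronglyMeasurable) (.of_forall fun t => ?_)
  rw [norm_mul]
  calc _ ≤ A * Real.exp (-δ * ‖γ.path t‖ ^ (d + 1)) * ‖deriv γ.path t‖ := by
        gcongr; exact h t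
    _ = _ := by ring

theorem tendsto_exp_neg {δ : ℝ} (hδ : 0 < δ) (A : ℝ) {F : Filter ℝ}
    (hF : Tendsto (fun t => ‖γ.path t‖) F atTop) :
    Tendsto (fun t => A * Real.exp (-δ * ‖γ.path t‖ ^ (d + 1))) F (𝓝 0) := by
  have h1 : Tendsto (fun r : ℝ => A * Real.exp (-δ * r ^ (d + 1))) atTop (𝓝 (A * 0)) := by
    refine Tendsto.const_mul A (Real.tendsto_exp_atBot.comp ?_)
    exact (tendsto_pow_atTop (by omega)).const_mul_atTop_of_neg (by linarith)
  rw [mul_zero] at h1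
  exact h1.comp hF

/-- The integral of a derivative vanishes if the primitive decays. -/
theorem integral_deriv_eq_zero {f f' : ℝ → ℂ} (hf : ∀ t, HasDerivAt f (f' t) t)
    (hf' : Integrable f') {δ A : ℝ} (hδ : 0 < δ)
    (h : ∀ t, ‖f t‖ ≤ A * Real.exp (-δ * ‖γ.path t‖ ^ (d + 1))) : ∫ t, f' t = 0 := by
  rw [integral_of_hasDerivAt_of_tendsto (m := 0) (n := 0) hf hf', sub_zero]
  · exact squeeze_zero_norm h (γ.tendsto_exp_neg hδ A γ.tendsto_source)
  · exact squeeze_zero_norm h (γ.tendsto_exp_neg hδ A γ.tendsto_target)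

end Contour

theorem norm_exp_le_exp_norm (z : ℂ) : ‖Complex.exp z‖ ≤ Real.exp ‖z‖ := by
  rw [Complex.norm_exp]
  exact Real.exp_le_exp.mpr (Complex.re_le_norm z)

/-! ### Fourier-Laplace transforms of polynomials. -/

namespace Contour

variable {c lead : ℂ} {d : ℕ} (γ : Contour c lead d)

theorem ne_zero_left (γ : Contour c lead d) : c ≠ 0 := by
  rintro rfl
  simpa using γ.source_spec

theorem ne_zero_right (γ : Contour c lead d) : lead ≠ 0 := by
  rintro rfl
  simpa using γ.source_spec

/-- The Fourier-Laplace transform `∫_γ q(y) exp (-c V(y)) exp (c x y) dy` of a polynomial. -/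
noncomputable def transform (V q : ℂ[X]) (x : ℂ) : ℂ :=
  γ.integral fun y => q.eval y * Complex.exp (-c * V.eval y) * Complex.exp (c * x * y)

variable {V : ℂ[X]}

/-- For `d ≥ 1` the exponent `c x y` has degree at most `d` in `y`, hence is of lower order than the
potential. Uniformity in `‖x‖ ≤ R` allows differentiation under the integral sign. -/
theorem exists_transform_bound (hd : 1 ≤ d) (hV : HasLead lead d V) (q : ℂ[X]) (R : ℝ) :
    ∃ δ > 0, ∃ A : ℝ, 0 ≤ A ∧ ∀ t : ℝ, ∀ x : ℂ, ‖x‖ ≤ R →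
      ‖q.eval (γ.path t) * Complex.exp (-c * V.eval (γ.path t)) *
        Complex.exp (c * x * γ.path t)‖ ≤ A * Real.exp (-δ * ‖γ.path t‖ ^ (d + 1)) := by
  obtain ⟨δ, hδ, A, hA, h⟩ := γ.exists_norm_mul_exp_le hV q (C (c * R) * X)
    ((natDegree_C_mul_le _ _).trans (natDegree_X_le.trans hd))
  refine ⟨δ, hδ, A, hA, fun t x hx => le_trans ?_ (h t)⟩
  rw [norm_mul, norm_mul]
  gcongr
  refine (norm_exp_le_exp_norm _).trans (Real.exp_le_exp.mpr ?_)
  simp only [eval_mul, eval_C, eval_X, norm_mul, Complex.norm_real, Real.norm_eq_abs]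
  gcongr
  exact hx.trans (le_abs_self R)

theorem continuous_transform_integrand (V q : ℂ[X]) (x : ℂ) : Continuous fun t =>
    q.eval (γ.path t) * Complex.exp (-c * V.eval (γ.path t)) * Complex.exp (c * x * γ.path t) := by
  have h := γ.continuous_path
  have h1 : Continuous fun t => q.eval (γ.path t) := q.continuous.comp h
  have h2 : Continuous fun t => V.eval (γ.path t) := V.continuous.comp h
  fun_prop

theorem integrable_transform (hd : 1 ≤ d) (hV : HasLead lead d V) (q : ℂ[X]) (x : ℂ) :
    Integrable fun t => q.eval (γ.path t) * Complex.exp (-c * V.eval (γ.path t)) *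
      Complex.exp (c * x * γ.path t) * deriv γ.path t := by
  obtain ⟨δ, hδ, A, hA, h⟩ := γ.exists_transform_bound hd hV q ‖x‖
  exact γ.integrable_of_norm_le (γ.continuous_transform_integrand V q x) hδ
    fun t => h t x le_rfl

theorem isLinearMap_transform (hd : 1 ≤ d) (hV : HasLead lead d V) (x : ℂ) :
    IsLinearMap ℂ fun q => γ.transform V q x where
  map_add p q := by
    simp only [transform, integral]
    rw [← integral_add (γ.integrable_transform hd hV p x) (γ.integrable_transform hd hV q x)]
    congr 1 with t
    rw [eval_add]
    ring
  map_smul a q := by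
    simp only [transform, integral]
    rw [smul_eq_mul, ← integral_const_mul]
    congr 1 with t
    rw [eval_smul, smul_eq_mul]
    ring

theorem hasDerivAt_weight (V q : ℂ[X]) (x : ℂ) (t : ℝ) :
    HasDerivAt (fun t => q.eval (γ.path t) * Complex.exp (-c * V.eval (γ.path t)) *
      Complex.exp (c * x * γ.path t))
      ((q.derivative.eval (γ.path t) + q.eval (γ.path t) *
        (-c * V.derivative.eval (γ.path t) + c * x)) * Complex.exp (-c * V.eval (γ.path t)) *
        Complex.exp (c * x * γ.path t) * deriv γ.path t) t := by
  have h0 : HasDerivAt (fun z : ℂ => q.eval z * Complex.exp (-c * V.eval z) *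
      Complex.exp (c * x * z)) ((q.derivative.eval (γ.path t) + q.eval (γ.path t) *
        (-c * V.derivative.eval (γ.path t) + c * x)) * Complex.exp (-c * V.eval (γ.path t)) *
        Complex.exp (c * x * γ.path t)) (γ.path t) := by
    have h1 := q.hasDerivAt (γ.path t)
    have h2 := ((V.hasDerivAt (γ.path t)).const_mul (-c)).cexp
    have h3 := ((hasDerivAt_id (γ.path t)).const_mul (c * x)).cexp
    refine ((h1.mul h2).mul h3).congr_deriv ?_
    simp only [id, Pi.mul_apply]
    ring
  exact HasDerivAt.comp t h0 (γ.hasDerivAt t)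

/-- Integration by parts. -/
theorem transform_derivative (hd : 1 ≤ d) (hV : HasLead lead d V) (q : ℂ[X]) (x : ℂ) :
    γ.transform V (derivative V * q - C c⁻¹ * derivative q) x = x * γ.transform V q x := by
  have hc := γ.ne_zero_left
  obtain ⟨δ, hδ, A, hA, h⟩ := γ.exists_transform_bound hd hV q ‖x‖
  have hint := (γ.integrable_transform hd hV (derivative q + q * (C (-c) * derivative V +
    C (c * x))) x)
  have h0 := γ.integral_deriv_eq_zero (fun t => γ.hasDerivAt_weight V q x t)
    (by simpa using hint) hδ fun t => h t x le_rfl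
  have h1 : c * γ.transform V (derivative V * q - C c⁻¹ * derivative q) x -
      c * (x * γ.transform V q x) = 0 := by
    rw [← neg_eq_zero, ← h0]
    simp only [transform, integral]
    rw [← mul_assoc, ← integral_const_mul, ← integral_const_mul, ← integral_sub,
      ← MeasureTheory.integral_neg]
    · congr 1 with t
      simp
      field_simp
      ring
    · exact (γ.integrable_transform hd hV _ x).const_mul c
    · exact (γ.integrable_transform hd hV _ x).const_mul (c * x)
  exact mul_left_cancel₀ hc (sub_eq_zero.mp h1)

theorem hasDerivAt_transform (hd : 1 ≤ d) (hV : HasLead lead d V) (q : ℂ[X]) (x : ℂ) :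
    HasDerivAt (γ.transform V q) (c * γ.transform V (X * q) x) x := by
  obtain ⟨δ, hδ, A, hA, h⟩ := γ.exists_transform_bound hd hV (X * q) (‖x‖ + 1)
  have hdiff : ∀ (t : ℝ) (y : ℂ), HasDerivAt (fun x => q.eval (γ.path t) *
      Complex.exp (-c * V.eval (γ.path t)) * Complex.exp (c * x * γ.path t) * deriv γ.path t)
      (c * ((X * q).eval (γ.path t) * Complex.exp (-c * V.eval (γ.path t)) *
        Complex.exp (c * y * γ.path t) * deriv γ.path t)) y := by
    intro t y
    have h3 := ((((hasDerivAt_id y).const_mul c).mul_const (γ.path t)).cexp.const_mul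
      (q.eval (γ.path t) * Complex.exp (-c * V.eval (γ.path t)))).mul_const (deriv γ.path t)
    refine h3.congr_deriv ?_
    rw [eval_mul, eval_X, id]
    ring
  have hbound : ∀ (t : ℝ), ∀ y ∈ Metric.ball x 1,
      ‖c * ((X * q).eval (γ.path t) * Complex.exp (-c * V.eval (γ.path t)) *
        Complex.exp (c * y * γ.path t) * deriv γ.path t)‖ ≤
      ‖c‖ * A * (‖deriv γ.path t‖ * Real.exp (-δ * ‖γ.path t‖ ^ (d + 1))) := by
    intro t y hy
    have hy' : ‖y‖ ≤ ‖x‖ + 1 := by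
      have := norm_le_norm_add_norm_sub' y x
      rw [mem_ball_iff_norm] at hy
      linarith
    rw [norm_mul, norm_mul _ (deriv _ _)]
    calc _ ≤ ‖c‖ * (A * Real.exp (-δ * ‖γ.path t‖ ^ (d + 1)) * ‖deriv γ.path t‖) := by
          gcongr
          exact h t y hy'
      _ = _ := by ring
  have h1 := (hasDerivAt_integral_of_dominated_loc_of_deriv_le
    (Metric.ball_mem_nhds x one_pos)
    (.of_forall fun y => (γ.integrable_transform hd hV q y).aestronglyMeasurable)
    (γ.integrable_transform hd hV q x)
    ((γ.integrable_transform hd hV (X * q) x).const_mul c).aestronglyMeasurable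
    (.of_forall hbound) ((γ.tame δ hδ).const_mul _)
    (.of_forall fun t y _ => hdiff t y)).2
  rw [MeasureTheory.integral_const_mul] at h1
  exact h1

end Contour

/-! ### Reduction to the leading weight, and its moments. -/

theorem hasLead_leadTerm (lead : ℂ) (d : ℕ) :
    HasLead lead d (C (lead / (d + 1)) * X ^ (d + 1)) := by
  simp [HasLead]

namespace Contour

variable {c lead : ℂ} {d : ℕ}

/-- The weight `exp (-c V)` can be replaced by its leading part within limits of transforms. -/
theorem tendsto_transform_leadTerm (γ : Contour c lead d) {V : ℂ[X]}
    (hV : HasLead lead d V) (q : ℂ[X]) :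
    Tendsto (fun n : ℕ => γ.transform V (q * ∑ j ∈ Finset.range n, C ((j.factorial : ℂ)⁻¹) *
      (C c * (V - C (lead / (d + 1)) * X ^ (d + 1))) ^ j) 0) atTop
      (𝓝 (γ.transform (C (lead / (d + 1)) * X ^ (d + 1)) q 0)) := by
  -- Multiplying `exp (-c V)` by `exp L` gives the leading weight. The partial sums of `exp L` are
  -- polynomials bounded by `exp ‖L‖`, and `L` has degree at most `d`, so the weight dominates them
  -- all.
  set L := C c * (V - C (lead / (d + 1)) * X ^ (d + 1)) with hL
  obtain ⟨δ, hδ, A, hA, h⟩ := γ.exists_norm_mul_exp_le hV q L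
    ((natDegree_C_mul_le _ _).trans hV)
  have hev : ∀ (n : ℕ) (z : ℂ), (∑ j ∈ Finset.range n, C ((j.factorial : ℂ)⁻¹) * L ^ j).eval z =
      ∑ j ∈ Finset.range n, (L.eval z) ^ j / j.factorial := by
    intro n z
    rw [eval_finsetSum]
    refine Finset.sum_congr rfl fun j _ => ?_
    simp only [eval_mul, eval_C, eval_pow]
    ring
  refine tendsto_integral_of_dominated_convergence
    (fun t => A * (‖deriv γ.path t‖ * Real.exp (-δ * ‖γ.path t‖ ^ (d + 1)))) (fun n =>
      ((γ.continuous_transform_integrand V _ 0).mul γ.continuous_deriv).aestronglyMeasurable)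
    ((γ.tame δ hδ).const_mul A) (fun n => .of_forall fun t => ?_) (.of_forall fun t => ?_)
  · rw [norm_mul, norm_mul, norm_mul, eval_mul, hev, norm_mul, mul_zero, zero_mul, Complex.exp_zero,
      norm_one, mul_one]
    have h1 : ‖∑ j ∈ Finset.range n, (L.eval (γ.path t)) ^ j / (j.factorial : ℂ)‖ ≤
        Real.exp ‖L.eval (γ.path t)‖ := by
      refine (norm_sum_le _ _).trans (le_trans (Finset.sum_le_sum fun j _ => ?_)
        (Real.sum_le_exp_of_nonneg (norm_nonneg _) n))
      rw [norm_div, norm_pow, Complex.norm_natCast]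
    calc _ ≤ ‖q.eval (γ.path t)‖ * Real.exp ‖L.eval (γ.path t)‖ *
          ‖Complex.exp (-c * V.eval (γ.path t))‖ * ‖deriv γ.path t‖ := by gcongr
      _ = ‖q.eval (γ.path t)‖ * ‖Complex.exp (-c * V.eval (γ.path t))‖ *
          Real.exp ‖L.eval (γ.path t)‖ * ‖deriv γ.path t‖ := by ring
      _ ≤ A * Real.exp (-δ * ‖γ.path t‖ ^ (d + 1)) * ‖deriv γ.path t‖ :=
          mul_le_mul_of_nonneg_right (h t) (norm_nonneg _)
      _ = _ := by ring
  · have h2 : Tendsto (fun n : ℕ => ∑ j ∈ Finset.range n,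
        (L.eval (γ.path t)) ^ j / (j.factorial : ℂ)) atTop
        (𝓝 (Complex.exp (L.eval (γ.path t)))) := by
      rw [Complex.exp_eq_exp_ℂ]
      exact (NormedSpace.expSeries_div_hasSum_exp (L.eval (γ.path t))).tendsto_sum_nat
    have h3 : Complex.exp (-c * (C (lead / (d + 1)) * X ^ (d + 1) : ℂ[X]).eval (γ.path t)) =
        Complex.exp (L.eval (γ.path t)) * Complex.exp (-c * V.eval (γ.path t)) := by
      rw [← Complex.exp_add]
      congr 1
      rw [hL]
      simp only [eval_mul, eval_C, eval_pow, eval_sub, eval_X]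
      ring
    have h4 : ∀ n : ℕ, (q * ∑ j ∈ Finset.range n, C ((j.factorial : ℂ)⁻¹) * L ^ j).eval
        (γ.path t) = q.eval (γ.path t) * ∑ j ∈ Finset.range n,
        (L.eval (γ.path t)) ^ j / (j.factorial : ℂ) := fun n => by rw [eval_mul, hev]
    simp only [h4]
    rw [h3]
    refine Tendsto.mul_const _ (Tendsto.mul_const _ ?_)
    simp only [← mul_assoc]
    exact (h2.const_mul _).mul_const _

/-- `∫_0^∞ t^m exp (-t^(d+1)/(d+1)) dt`. -/
noncomputable def _root_.TwoMatrix.rayMoment (d m : ℕ) : ℝ :=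
  ∫ t in Set.Ioi (0 : ℝ), t ^ m * Real.exp (-t ^ (d + 1) / (d + 1))

theorem _root_.TwoMatrix.rayMoment_pos (d m : ℕ) : 0 < rayMoment d m := by
  have h := integral_rpow_mul_exp_neg_mul_rpow (p := (d + 1 : ℝ)) (q := m)
    (b := 1 / (d + 1)) (by positivity) (by have : (0 : ℝ) ≤ m := by positivity
                                           linarith) (by positivity)
  have h2 : rayMoment d m = ∫ x in Set.Ioi (0 : ℝ), x ^ (m : ℝ) *
      Real.exp (-(1 / (d + 1)) * x ^ (d + 1 : ℝ)) := by
    refine setIntegral_congr_fun measurableSet_Ioi fun t _ => ?_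
    have : t ^ (d + 1 : ℝ) = t ^ (d + 1) := by exact_mod_cast Real.rpow_natCast t (d + 1)
    simp only [this, Real.rpow_natCast]
    ring_nf
  rw [h2, h]
  have : 0 < Real.Gamma ((m + 1) / (d + 1 : ℝ)) := Real.Gamma_pos_of_pos (by positivity)
  positivity

theorem _root_.TwoMatrix.integrableOn_rayMoment (d m : ℕ) :
    IntegrableOn (fun t : ℝ => t ^ m * Real.exp (-t ^ (d + 1) / (d + 1))) (Set.Ioi 0) := by
  have h := integrableOn_rpow_mul_exp_neg_mul_rpow (p := (d + 1 : ℝ)) (s := m)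
    (b := 1 / (d + 1)) (by have : (0 : ℝ) ≤ m := by positivity
                           linarith) (by have : (0 : ℝ) ≤ d := by positivity
                                         linarith) (by positivity)
  refine h.congr_fun (fun t _ => ?_) measurableSet_Ioi
  have : t ^ (d + 1 : ℝ) = t ^ (d + 1) := by exact_mod_cast Real.rpow_natCast t (d + 1)
  simp only [this, Real.rpow_natCast]
  ring_nf

/-- The weight `z^m exp (-A z^(d+1)/(d+1))`. -/
noncomputable def _root_.TwoMatrix.monoWeight (A : ℂ) (d m : ℕ) (z : ℂ) : ℂ :=
  z ^ m * Complex.exp (-(A * z ^ (d + 1)) / (d + 1))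

theorem _root_.TwoMatrix.norm_monoWeight_le {A u z : ℂ} {d : ℕ} (m : ℕ)
    (hu : A * u ^ (d + 1) = 1) {θ : ℝ} (hθ : θ < Real.pi / (2 * (d + 1)))
    (hz : |Complex.arg (z / u)| ≤ θ) :
    ‖monoWeight A d m z‖ ≤
      ‖z‖ ^ m * Real.exp (-(Real.cos ((d + 1) * θ) / (d + 1)) * ‖z / u‖ ^ (d + 1)) := by
  have h1 := re_mul_pow_ge hu hθ hz
  rw [monoWeight, norm_mul, norm_pow, Complex.norm_exp]
  gcongr
  have : -(A * z ^ (d + 1)) / ((d : ℂ) + 1) = -(A * z ^ (d + 1)) / ((d + 1 : ℝ) : ℂ) := by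
    push_cast; rfl
  rw [this, Complex.div_ofReal_re, Complex.neg_re, neg_mul, neg_div, neg_le_neg_iff,
    div_mul_eq_mul_div]
  gcongr

/-- Moves from `z` to the bisecting ray of its sector along a circular arc: the arc subtends an
angle at most `θ`, and the sector bound for the weight holds all along it. Thus a primitive has the
same limit along all paths to infinity in the sector. -/
theorem _root_.TwoMatrix.norm_sub_le_of_hasDerivAt_monoWeight {A u z : ℂ} {d : ℕ} (m : ℕ)
    (hu : A * u ^ (d + 1) = 1) {θ : ℝ} (hθ : θ < Real.pi / (2 * (d + 1)))
    (hz : |Complex.arg (z / u)| ≤ θ) {G : ℂ → ℂ} (hG : ∀ z, HasDerivAt G (monoWeight A d m z) z) :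
    ‖G z - G (u * ‖z / u‖)‖ ≤ ‖z‖ ^ (m + 1) *
      Real.exp (-(Real.cos ((d + 1) * θ) / (d + 1)) * ‖z / u‖ ^ (d + 1)) * θ := by
  have hu0 : u ≠ 0 := by
    rintro rfl
    simp at hu
  have hθ0 : 0 ≤ θ := (abs_nonneg _).trans hz
  have hθπ : θ < Real.pi := by
    refine hθ.trans_le (div_le_self Real.pi_pos.le ?_)
    have : (0 : ℝ) ≤ d := by positivity
    linarith
  set ρ := ‖z / u‖ with hρ
  set f : ℝ → ℂ := fun β => G (u * ρ * Complex.exp (β * Complex.I)) with hf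
  have hnorm : ∀ β : ℝ, ‖u * ρ * Complex.exp (β * Complex.I)‖ = ‖z‖ := by
    intro β
    rw [norm_mul, norm_mul, Complex.norm_exp_ofReal_mul_I, Complex.norm_real, hρ, norm_norm,
      norm_div, mul_one]
    field_simp
  have hfd : ∀ β : ℝ, HasDerivAt f (monoWeight A d m (u * ρ * Complex.exp (β * Complex.I)) *
      (u * ρ * Complex.exp (β * Complex.I) * Complex.I)) β := by
    intro β
    have h1 : HasDerivAt (fun w : ℂ => u * ρ * Complex.exp (w * Complex.I))
        (u * ρ * Complex.exp (β * Complex.I) * Complex.I) (β : ℂ) := by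
      refine ((((hasDerivAt_id (β : ℂ)).mul_const Complex.I).cexp).const_mul
        (u * ρ)).congr_deriv ?_
      simp only [id]
      ring
    exact ((hG _).comp (β : ℂ) h1).comp_ofReal
  have hb : ∀ β ∈ Set.Icc (-θ) θ, ‖monoWeight A d m (u * ρ * Complex.exp (β * Complex.I)) *
      (u * ρ * Complex.exp (β * Complex.I) * Complex.I)‖ ≤ ‖z‖ ^ (m + 1) *
      Real.exp (-(Real.cos ((d + 1) * θ) / (d + 1)) * ρ ^ (d + 1)) := by
    intro β hβ
    rw [norm_mul, norm_mul _ Complex.I, Complex.norm_I, hnorm, mul_one]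
    rcases eq_or_ne ρ 0 with h0 | h0
    · have : ‖z‖ = 0 := by rw [← hnorm 0, h0]; simp
      simp [this]
    have hρ0 : 0 < ρ := lt_of_le_of_ne (norm_nonneg _) (Ne.symm h0)
    have hdiv : u * ρ * Complex.exp (β * Complex.I) / u = ρ * Complex.exp (β * Complex.I) := by
      field_simp
    have harg : Complex.arg (u * ρ * Complex.exp (β * Complex.I) / u) = β := by
      have hmem : β ∈ Set.Ioc (-Real.pi) (-Real.pi + 2 * Real.pi) :=
        ⟨by linarith [hβ.1], by linarith [hβ.2]⟩
      rw [hdiv, Complex.arg_real_mul _ hρ0, Complex.arg_exp_mul_I,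
        (toIocMod_eq_self Real.two_pi_pos).mpr hmem]
    have h2 := norm_monoWeight_le m hu hθ (z := u * ρ * Complex.exp (β * Complex.I))
      (by rw [harg, abs_le]; exact hβ)
    rw [hnorm, hdiv, norm_mul, Complex.norm_exp_ofReal_mul_I, mul_one, Complex.norm_real,
      Real.norm_of_nonneg hρ0.le] at h2
    calc _ ≤ _ := mul_le_mul_of_nonneg_right h2 (norm_nonneg z)
      _ = _ := by ring
  have hz' : f (Complex.arg (z / u)) = G z := by
    simp only [hf, hρ]
    rw [mul_assoc, Complex.norm_mul_exp_arg_mul_I]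
    congr 1
    field_simp
  have h0' : f 0 = G (u * ρ) := by simp [hf]
  have h3 := (convex_Icc (-θ) θ).norm_image_sub_le_of_norm_hasDerivWithin_le
    (fun β _ => (hfd β).hasDerivWithinAt) hb (x := 0) (y := Complex.arg (z / u))
    ⟨by linarith, hθ0⟩ (abs_le.mp hz)
  rw [hz', h0'] at h3
  refine h3.trans ?_
  gcongr
  rw [sub_zero]
  exact hz

theorem _root_.TwoMatrix.tendsto_pow_mul_exp_neg_mul_pow (n d : ℕ) {η : ℝ} (hη : 0 < η) :
    Tendsto (fun r : ℝ => r ^ n * Real.exp (-η * r ^ (d + 1))) atTop (𝓝 0) := by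
  obtain ⟨A, hA, h⟩ := exists_norm_eval_le_mul_exp d (X ^ n : ℂ[X]) (half_pos hη)
  refine squeeze_zero_norm' (a := fun r => A * Real.exp (-(η / 2) * r ^ (d + 1))) ?_ ?_
  · filter_upwards [eventually_ge_atTop 0] with r hr
    have h1 := h (r : ℂ)
    simp only [eval_pow, eval_X, norm_pow, Complex.norm_real, Real.norm_of_nonneg hr] at h1
    rw [norm_mul, norm_pow, Real.norm_of_nonneg hr, Real.norm_of_nonneg (Real.exp_pos _).le]
    calc _ ≤ A * Real.exp (η / 2 * r ^ (d + 1)) * Real.exp (-η * r ^ (d + 1)) := by gcongr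
      _ = _ := by
        rw [mul_assoc, ← Real.exp_add]
        congr 2
        ring
  · rw [← mul_zero A]
    refine Tendsto.const_mul A (Real.tendsto_exp_atBot.comp ?_)
    exact (tendsto_pow_atTop (by omega)).const_mul_atTop_of_neg (by linarith)

/-- On the ray `z = u r` the relation `A * u ^ (d + 1) = 1` makes the weight real up to a power of
`u`, so the limit is a ray moment. The arc estimate reduces any other path to the ray. -/
theorem _root_.TwoMatrix.tendsto_primitive_monoWeight {A u : ℂ} {d : ℕ} (m : ℕ)
    (hu : A * u ^ (d + 1) = 1) {θ : ℝ} (hθ : θ < Real.pi / (2 * (d + 1))) (hθ0 : 0 ≤ θ)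
    {G : ℂ → ℂ} (hG : ∀ z, HasDerivAt G (monoWeight A d m z) z) (hG0 : G 0 = 0)
    {F : Filter ℝ} {p : ℝ → ℂ} (hp : Tendsto (fun t => ‖p t‖) F atTop)
    (hs : ∀ᶠ t in F, |Complex.arg (p t / u)| ≤ θ) :
    Tendsto (fun t => G (p t)) F (𝓝 (u ^ (m + 1) * rayMoment d m)) := by
  have hu0 : u ≠ 0 := by
    rintro rfl
    simp at hu
  have hρ : Tendsto (fun t => ‖p t / u‖) F atTop := by
    simp only [norm_div]
    exact hp.atTop_div_const (by positivity)
  have hray : Tendsto (fun r : ℝ => G (u * r)) atTop (𝓝 (u ^ (m + 1) * rayMoment d m)) := by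
    have h1 := intervalIntegral_tendsto_integral_Ioi 0 (integrableOn_rayMoment d m) tendsto_id
    have h2 : ∀ r : ℝ, G (u * r) = u ^ (m + 1) *
        ((∫ t in (0 : ℝ)..r, t ^ m * Real.exp (-t ^ (d + 1) / (d + 1)) : ℝ) : ℂ) := by
      intro r
      rw [← intervalIntegral.integral_ofReal, ← intervalIntegral.integral_const_mul]
      have h3 : ∀ t : ℝ, HasDerivAt (fun t : ℝ => G (u * t)) (u ^ (m + 1) *
          ((t ^ m * Real.exp (-t ^ (d + 1) / (d + 1)) : ℝ) : ℂ)) t := by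
        intro t
        have h4 : HasDerivAt (fun w : ℂ => u * w) u (t : ℂ) := by
          simpa using (hasDerivAt_id (t : ℂ)).const_mul u
        refine (((hG _).comp (t : ℂ) h4).comp_ofReal).congr_deriv ?_
        rw [monoWeight, mul_pow u (t : ℂ) (d + 1), ← mul_assoc A, hu, one_mul]
        push_cast
        ring
      rw [intervalIntegral.integral_eq_sub_of_hasDerivAt (fun t _ => h3 t)
        (Continuous.intervalIntegrable (by fun_prop) _ _)]
      simp [hG0]
    simp only [h2]
    exact ((Complex.continuous_ofReal.tendsto _).comp h1).const_mul _
  have hcos := cos_pos_of_lt hθ hθ0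
  have hsub : Tendsto (fun t => G (p t) - G (u * ‖p t / u‖)) F (𝓝 0) := by
    refine squeeze_zero_norm' (a := fun t => ‖u‖ ^ (m + 1) * (‖p t / u‖ ^ (m + 1) *
      Real.exp (-(Real.cos ((d + 1) * θ) / (d + 1)) * ‖p t / u‖ ^ (d + 1))) * θ) ?_ ?_
    · filter_upwards [hs] with t ht
      refine (norm_sub_le_of_hasDerivAt_monoWeight m hu hθ ht hG).trans (le_of_eq ?_)
      have h6 : ‖p t‖ ^ (m + 1) = ‖u‖ ^ (m + 1) * ‖p t / u‖ ^ (m + 1) := by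
        rw [← mul_pow, norm_div]
        congr 1
        field_simp
      rw [h6]
      ring
    · have h5 := ((((tendsto_pow_mul_exp_neg_mul_pow (m + 1) d
        (η := Real.cos ((d + 1) * θ) / (d + 1)) (by positivity)).comp hρ).const_mul
        (‖u‖ ^ (m + 1))).mul_const θ)
      simpa using h5
  have := hsub.add (hray.comp hρ)
  simpa using this

/-- The weight has an entire primitive, and its limits at the ends of the contour depend only on the
two sectors. -/
theorem transform_leadTerm (γ : Contour c lead d) (hd : 1 ≤ d) (m : ℕ) :
    γ.transform (C (lead / (d + 1)) * X ^ (d + 1)) (X ^ m) 0 =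
      rayMoment d m * (γ.target ^ (m + 1) - γ.source ^ (m + 1)) := by
  have hdiff : Differentiable ℂ (monoWeight (c * lead) d m) := by
    unfold monoWeight
    fun_prop
  obtain ⟨G, hG0, hG⟩ := hdiff.isExactOn_univ.with_val_at 0 0
  replace hG : ∀ z, HasDerivAt G (monoWeight (c * lead) d m z) z := fun z => hG z trivial
  obtain ⟨θ₁, hθ₁, hs₁⟩ := γ.sector_source
  obtain ⟨θ₂, hθ₂, hs₂⟩ := γ.sector_target
  have h01 : 0 ≤ θ₁ := by
    obtain ⟨t, ht⟩ := hs₁.exists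
    exact (abs_nonneg _).trans ht
  have h02 : 0 ≤ θ₂ := by
    obtain ⟨t, ht⟩ := hs₂.exists
    exact (abs_nonneg _).trans ht
  have hint := γ.integrable_transform hd (hasLead_leadTerm lead d) (X ^ m) 0
  have heq : ∀ t : ℝ, (X ^ m : ℂ[X]).eval (γ.path t) *
      Complex.exp (-c * (C (lead / (d + 1)) * X ^ (d + 1) : ℂ[X]).eval (γ.path t)) *
      Complex.exp (c * 0 * γ.path t) * deriv γ.path t =
      monoWeight (c * lead) d m (γ.path t) * deriv γ.path t := by
    intro t
    simp only [eval_pow, eval_X, eval_mul, eval_C, mul_zero, zero_mul, Complex.exp_zero, mul_one,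
      monoWeight]
    congr 3
    ring
  simp only [transform, integral]
  simp only [heq] at hint ⊢
  rw [integral_of_hasDerivAt_of_tendsto (fun t => (hG _).comp t (γ.hasDerivAt t)) hint
    (tendsto_primitive_monoWeight m γ.source_spec hθ₁ h01 hG hG0 γ.tendsto_source hs₁)
    (tendsto_primitive_monoWeight m γ.target_spec hθ₂ h02 hG hG0 γ.tendsto_target hs₂)]
  ring

end Contour

/-! ### Independence of the moment functionals of the contours. -/

/-- Integer vectors that are independent over `ℤ` are independent over `ℂ`. -/
theorem eq_zero_of_sum_mul_intCast_eq_zero {ι κ : Type*} [Fintype ι] {v : ι → κ →₀ ℤ}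
    (hv : LinearIndependent ℤ v) (a : ι → ℂ) (h : ∀ u, ∑ k, a k * (v k u : ℂ) = 0) : a = 0 := by
  -- Each coordinate of the complex coefficients in a rational basis of `ℂ` gives a rational
  -- relation between the vectors; clearing denominators makes it an integral one.
  let B := Module.Basis.ofVectorSpace ℚ ℂ
  have key : ∀ b, ∀ k, B.repr (a k) b = 0 := by
    intro b
    obtain ⟨M, hM⟩ := IsLocalization.exist_integer_multiples_of_finite (nonZeroDivisors ℤ)
      (fun k => B.repr (a k) b)
    choose z hz using hM
    have hM0 : ((M : ℤ) : ℚ) ≠ 0 := by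
      have := nonZeroDivisors.ne_zero M.2
      exact_mod_cast this
    have h1 : ∀ u, ∑ k, z k * v k u = 0 := by
      intro u
      have h2 := congrArg (fun w => B.repr w b) (h u)
      have h3 : ∀ k, B.repr (a k * (v k u : ℂ)) b = (v k u : ℚ) * B.repr (a k) b := by
        intro k
        have : a k * (v k u : ℂ) = (v k u : ℚ) • a k := by
          rw [Rat.smul_def]; push_cast; ring
        rw [this]
        simp
      simp only [map_sum, Finsupp.coe_finsetSum, Finset.sum_apply, h3, map_zero,
        Finsupp.coe_zero, Pi.zero_apply] at h2
      have h4 : ((∑ k, z k * v k u : ℤ) : ℚ) = (M : ℤ) * ∑ k, (v k u : ℚ) * B.repr (a k) b := by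
        rw [Finset.mul_sum]
        push_cast
        refine Finset.sum_congr rfl fun k _ => ?_
        have h5 := hz k
        simp only [eq_intCast, zsmul_eq_mul] at h5
        rw [h5]
        ring
      rw [h2, mul_zero] at h4
      exact_mod_cast h4
    have h6 := Fintype.linearIndependent_iff.mp hv z (by
      ext u
      simpa using h1 u)
    intro k
    have h5 := hz k
    rw [h6 k] at h5
    simp only [map_zero, zsmul_eq_mul] at h5
    exact (mul_eq_zero.mp h5.symm).resolve_left hM0
  funext k
  apply B.repr.injective
  ext b
  simp [key b k]

/-- Only the trivial combination of homologically independent contours annihilates all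
polynomials. -/
theorem eq_zero_of_sum_transform_eq_zero {c lead : ℂ} {d : ℕ} (hd : 1 ≤ d) {ι : Type*} [Fintype ι]
    (γ : ι → Contour c lead d) (hγ : LinearIndependent ℤ fun k => (γ k).homologyClass)
    {V : ℂ[X]} (hV : HasLead lead d V) (a : ι → ℂ)
    (h : ∀ q, ∑ k, a k * (γ k).transform V q 0 = 0) : a = 0 := by
  -- The relation passes to the leading weight as a limit of relations for polynomials.
  have h1 : ∀ q, ∑ k, a k * (γ k).transform (C (lead / (d + 1)) * X ^ (d + 1)) q 0 = 0 := by
    intro q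
    have := tendsto_finsetSum Finset.univ fun k _ =>
      ((γ k).tendsto_transform_leadTerm hV q).const_mul (a k)
    simp only [h] at this
    exact tendsto_nhds_unique this tendsto_const_nhds |>.symm ▸ rfl
  have h2 : ∀ m : ℕ, ∑ k, a k * ((γ k).target ^ m - (γ k).source ^ m) = 0 := by
    rintro (_ | m)
    · simp
    · have h3 := h1 (X ^ m)
      simp only [Contour.transform_leadTerm _ hd, mul_left_comm (a _)] at h3
      rw [← Finset.mul_sum] at h3
      refine (mul_eq_zero.mp h3).resolve_left ?_
      exact_mod_cast (rayMoment_pos d m).ne'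
  have h3 : ∀ p : ℂ[X], ∑ k, a k * (p.eval (γ k).target - p.eval (γ k).source) = 0 := by
    intro p
    induction p using Polynomial.induction_on' with
    | add p q hp hq =>
      rw [← add_zero (0 : ℂ)]
      nth_rw 1 [← hp]
      rw [← hq, ← Finset.sum_add_distrib]
      refine Finset.sum_congr rfl fun k _ => ?_
      simp only [eval_add]
      ring
    | monomial m b =>
      rw [← mul_zero b, ← h2 m, Finset.mul_sum]
      refine Finset.sum_congr rfl fun k _ => ?_
      simp only [eval_monomial]
      ring
  refine eq_zero_of_sum_mul_intCast_eq_zero hγ a fun u => ?_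
  classical
  let S : Finset ℂ := Finset.univ.image (fun k => (γ k).target) ∪
    Finset.univ.image fun k => (γ k).source
  -- The polynomial that is `1` at the node `u` and `0` at the other end sectors reads off the
  -- coefficient at `u` of the combination of homology classes. If `u` is not a node, all values
  -- vanish.
  have h4 : ∀ v ∈ S, (Lagrange.interpolate S id fun v => if v = u then (1 : ℂ) else 0).eval v =
      if v = u then (1 : ℂ) else 0 := fun v hv =>
    Lagrange.eval_interpolate_at_node _ (Set.injOn_id _) hv
  rw [← h3 (Lagrange.interpolate S id fun v => if v = u then (1 : ℂ) else 0)]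
  refine Finset.sum_congr rfl fun k _ => ?_
  rw [h4 _ (by simp [S]), h4 _ (by simp [S]), Contour.homologyClass]
  simp [Finsupp.single_apply]

/-! ### Potentials, and the Wronskian of the Fourier-Laplace transforms. -/

theorem hasLead_potential (d : ℕ) (g : ℕ → ℂ) : HasLead (g (d + 1)) d (potential d g) := by
  have h : potential d g - C (g (d + 1) / (d + 1)) * X ^ (d + 1) =
      C (g 0) + ∑ k ∈ Finset.Icc 1 d, C (g k / k) * X ^ k := by
    rw [potential, Finset.sum_Icc_succ_top (by omega)]
    push_cast
    ring
  rw [HasLead, h]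
  refine natDegree_add_le_of_degree_le (by simp) (natDegree_sum_le_of_forall_le _ _ fun k hk => ?_)
  exact (natDegree_C_mul_X_pow_le _ _).trans (Finset.mem_Icc.mp hk).2

theorem derivative_potential (d : ℕ) (g : ℕ → ℂ) :
    derivative (potential d g) = ∑ k ∈ Finset.range (d + 1), C (g (k + 1)) * X ^ k := by
  rw [potential, derivative_add, derivative_C, zero_add, derivative_sum]
  refine Finset.sum_nbij' (fun k => k - 1) (fun k => k + 1) ?_ ?_ ?_ ?_ ?_
  · intro k hk
    simp only [Finset.mem_Icc, Finset.mem_range] at hk ⊢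
    omega
  · intro k hk
    simp only [Finset.mem_Icc, Finset.mem_range] at hk ⊢
    omega
  · intro k hk
    simp only [Finset.mem_Icc] at hk
    omega
  · intro k _
    omega
  · intro k hk
    obtain ⟨j, rfl⟩ : ∃ j, k = j + 1 := ⟨k - 1, by simp only [Finset.mem_Icc] at hk; omega⟩
    rw [derivative_C_mul_X_pow, Nat.add_sub_cancel, div_mul_cancel₀]
    exact_mod_cast Nat.succ_ne_zero j

/-- The derivative of a determinant, by rows. -/
theorem hasDerivAt_det {ι : Type*} [Fintype ι] [DecidableEq ι] {M : ℂ → Matrix ι ι ℂ}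
    {M' : Matrix ι ι ℂ} {x : ℂ} (h : ∀ i k, HasDerivAt (fun z => M z i k) (M' i k) x) :
    HasDerivAt (fun z => (M z).det) (∑ i, ((M x).updateRow i (M' i)).det) x := by
  have h1 : ∀ s : Equiv.Perm ι, HasDerivAt (fun z => Equiv.Perm.sign s • ∏ i, M z i (s i))
      (Equiv.Perm.sign s • ∑ i, (∏ j ∈ Finset.univ.erase i, M x j (s j)) • M' i (s i)) x := by
    intro s
    exact (HasDerivAt.fun_finsetProd fun i _ => h i (s i)).const_smul _
  have h2 : ∀ A : Matrix ι ι ℂ, A.det = ∑ s : Equiv.Perm ι, Equiv.Perm.sign s • ∏ i, A i (s i) := by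
    intro A
    rw [← Matrix.det_transpose, Matrix.det_apply]
    rfl
  simp only [h2]
  refine (HasDerivAt.fun_sum fun s _ => h1 s).congr_deriv ?_
  rw [Finset.sum_comm]
  refine Finset.sum_congr rfl fun s _ => ?_
  rw [Finset.smul_sum]
  refine Finset.sum_congr rfl fun i _ => ?_
  rw [← Finset.mul_prod_erase _ _ (Finset.mem_univ i), Matrix.updateRow_self, smul_eq_mul,
    mul_comm (M' i (s i))]
  congr 2
  refine Finset.prod_congr rfl fun j hj => ?_
  rw [Matrix.updateRow_ne (Finset.ne_of_mem_erase hj)]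

section Wronskian

variable {c : ℂ} {d : ℕ} {g : ℕ → ℂ}

/-- Integration by parts for a monomial: since the leading coefficient is nonzero, it determines the
moment of order `d + j` from lower ones. The truncated `j - 1` is harmless at `j = 0`, where its
factor vanishes. -/
theorem Contour.transform_pow_add (γ : Contour c (g (d + 1)) d) (hd : 1 ≤ d) (j : ℕ) (x : ℂ) :
    ∑ k ∈ Finset.range (d + 1), g (k + 1) * γ.transform (potential d g) (X ^ (k + j)) x =
      x * γ.transform (potential d g) (X ^ j) x +
        c⁻¹ * (j * γ.transform (potential d g) (X ^ (j - 1)) x) := by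
  have h := γ.transform_derivative hd (hasLead_potential d g) (X ^ j) x
  let S := IsLinearMap.mk' _ (γ.isLinearMap_transform hd (hasLead_potential d g) x)
  have hS : ∀ q, γ.transform (potential d g) q x = S q := fun q => rfl
  simp only [hS] at h ⊢
  have h1 : derivative (potential d g) * X ^ j =
      ∑ k ∈ Finset.range (d + 1), g (k + 1) • (X ^ (k + j) : ℂ[X]) := by
    rw [derivative_potential, Finset.sum_mul]
    refine Finset.sum_congr rfl fun k _ => ?_
    rw [smul_eq_C_mul, pow_add, mul_assoc]
  have h2 : C c⁻¹ * derivative (X ^ j : ℂ[X]) = c⁻¹ • ((j : ℂ) • (X ^ (j - 1) : ℂ[X])) := by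
    rw [derivative_X_pow, smul_eq_C_mul, smul_eq_C_mul]
  rw [h1, h2, map_sub, map_sum] at h
  simp only [map_smul, smul_eq_mul] at h
  linear_combination h

/-- The matrix of the first moments of `d` contours. -/
noncomputable def wronskianMatrix (γ : Fin d → Contour c (g (d + 1)) d) (x : ℂ) :
    Matrix (Fin d) (Fin d) ℂ :=
  Matrix.of fun i k => (γ k).transform (potential d g) (X ^ (i : ℕ)) x

/-- Liouville's formula. Differentiating a row gives `c` times the next one, so every row except the
last contributes a determinant with a repeated row. The recurrence expresses the derivative of the
last row through all rows, and only the coefficient of that row itself survives. -/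
theorem hasDerivAt_det_wronskianMatrix (hd : 1 ≤ d) (γ : Fin d → Contour c (g (d + 1)) d)
    (x : ℂ) : HasDerivAt (fun z => (wronskianMatrix γ z).det)
      (c * (-(g d / g (d + 1)) + if d = 1 then x / g 2 else 0) * (wronskianMatrix γ x).det) x := by
  have hg : g (d + 1) ≠ 0 := (γ ⟨0, hd⟩).ne_zero_right
  obtain ⟨e, rfl⟩ : ∃ e, d = e + 1 := ⟨d - 1, by omega⟩
  refine (hasDerivAt_det (M' := Matrix.of fun i k => c * (γ k).transform (potential (e + 1) g)
    (X ^ ((i : ℕ) + 1)) x) fun i k => ?_).congr_deriv ?_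
  · have h := (γ k).hasDerivAt_transform hd (hasLead_potential _ g) (X ^ (i : ℕ)) x
    rw [← pow_succ'] at h
    exact h
  rw [Fin.sum_univ_castSucc, Finset.sum_eq_zero, zero_add]
  · let b : Fin (e + 1) → ℂ := fun j => c / g (e + 1 + 1) * ((if j = 0 then x else 0) - g (j + 1))
    have hrow : (Matrix.of fun (i k : Fin (e + 1)) => c * (γ k).transform (potential (e + 1) g)
        (X ^ ((i : ℕ) + 1)) x) (Fin.last e) = ∑ j, b j • wronskianMatrix γ x j := by
      funext k
      have h := (γ k).transform_pow_add hd 0 x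
      rw [Finset.sum_range_succ, Finset.sum_range] at h
      simp only [add_zero, Nat.cast_zero, zero_mul, mul_zero] at h
      simp only [Matrix.of_apply, Fin.val_last, Finset.sum_apply, Pi.smul_apply, smul_eq_mul,
        wronskianMatrix, b, mul_assoc, sub_mul]
      rw [← Finset.mul_sum, Finset.sum_sub_distrib]
      simp only [ite_mul, zero_mul, Finset.sum_ite_eq', Finset.mem_univ, if_true, Fin.val_zero]
      rw [← h]
      field_simp
      ring
    rw [hrow, Matrix.det_updateRow_sum]
    simp only [b, Fin.val_last, smul_eq_mul]
    congr 1
    rcases e with _ | e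
    · simp
      field_simp
      ring
    · have : Fin.last (e + 1) ≠ 0 := (Fin.last_pos).ne'
      simp [this]
      field_simp
  · intro i _
    have hrow : (Matrix.of fun (i k : Fin (e + 1)) => c * (γ k).transform (potential (e + 1) g)
        (X ^ ((i : ℕ) + 1)) x) i.castSucc = c • wronskianMatrix γ x i.succ := by
      funext k
      simp [wronskianMatrix]
    rw [hrow, Matrix.det_updateRow_smul, Matrix.det_updateRow_eq_zero (Fin.castSucc_lt_succ).ne',
      mul_zero]

/-- A kernel vector is a combination of contours that kills the first `d` moments. The recurrence
then kills all of them, and independence of the contours makes the vector zero. -/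
theorem det_wronskianMatrix_zero_ne_zero (hd : 1 ≤ d) (γ : Fin d → Contour c (g (d + 1)) d)
    (hγ : LinearIndependent ℤ fun k => (γ k).homologyClass) :
    (wronskianMatrix γ 0).det ≠ 0 := by
  have hg : g (d + 1) ≠ 0 := (γ ⟨0, hd⟩).ne_zero_right
  intro hdet
  obtain ⟨v, hv, hv0⟩ := Matrix.exists_mulVec_eq_zero_iff.mpr hdet
  refine hv (eq_zero_of_sum_transform_eq_zero hd γ hγ (hasLead_potential d g) v ?_)
  have hlin : IsLinearMap ℂ fun q => ∑ k, v k * (γ k).transform (potential d g) q 0 := by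
    constructor
    · intro p q
      simp only [((γ _).isLinearMap_transform hd (hasLead_potential d g) 0).map_add, mul_add,
        Finset.sum_add_distrib]
    · intro a q
      simp only [((γ _).isLinearMap_transform hd (hasLead_potential d g) 0).map_smul, smul_eq_mul,
        Finset.mul_sum, mul_left_comm (v _)]
  have hpow : ∀ m : ℕ, ∑ k, v k * (γ k).transform (potential d g) (X ^ m) 0 = 0 := by
    intro m
    induction m using Nat.strong_induction_on with
    | _ m ih =>
      rcases lt_or_ge m d with hm | hm
      · have := congrFun hv0 ⟨m, hm⟩
        simp only [Matrix.mulVec, dotProduct, wronskianMatrix, Matrix.of_apply] at this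
        simpa [mul_comm] using this
      · obtain ⟨j, rfl⟩ := Nat.exists_eq_add_of_le hm
        have h : ∀ k, (γ k).transform (potential d g) (X ^ (d + j)) 0 = (g (d + 1))⁻¹ *
            (c⁻¹ * (j * (γ k).transform (potential d g) (X ^ (j - 1)) 0) -
            ∑ i ∈ Finset.range d, g (i + 1) *
              (γ k).transform (potential d g) (X ^ (i + j)) 0) := by
          intro k
          have h := (γ k).transform_pow_add hd j 0
          rw [Finset.sum_range_succ] at h
          field_simp
          linear_combination h
        have h1 : (j : ℂ) * ∑ k, v k * (γ k).transform (potential d g) (X ^ (j - 1)) 0 = 0 := by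
          rw [ih (j - 1) (by omega), mul_zero]
        have h2 : ∑ i ∈ Finset.range d, g (i + 1) * ∑ k, v k *
            (γ k).transform (potential d g) (X ^ (i + j)) 0 = 0 :=
          Finset.sum_eq_zero fun i hi => by
            rw [ih (i + j) (by have := Finset.mem_range.mp hi; omega), mul_zero]
        calc _ = (g (d + 1))⁻¹ * (c⁻¹ * ((j : ℂ) * ∑ k, v k *
              (γ k).transform (potential d g) (X ^ (j - 1)) 0) -
              ∑ i ∈ Finset.range d, g (i + 1) * ∑ k, v k *
              (γ k).transform (potential d g) (X ^ (i + j)) 0) := by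
              simp only [h, Finset.mul_sum]
              rw [Finset.sum_comm (s := Finset.range d), ← Finset.sum_sub_distrib, Finset.mul_sum]
              refine Finset.sum_congr rfl fun k _ => ?_
              rw [mul_sub, mul_sub, mul_sub, Finset.mul_sum, Finset.mul_sum, Finset.mul_sum]
              congr 1
              · ring
              · exact Finset.sum_congr rfl fun i _ => by ring
          _ = 0 := by rw [h1, h2]; ring
  intro q
  induction q using Polynomial.induction_on' with
  | add p q hp hq => rw [hlin.map_add, hp, hq, add_zero]
  | monomial m b =>
    rw [← mul_one b, ← smul_eq_mul, ← smul_monomial, hlin.map_smul, ← X_pow_eq_monomial, hpow,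
      smul_zero]

/-- The Wronskian of the Fourier-Laplace transforms in closed form. -/
theorem exists_det_wronskianMatrix_eq (hd : 1 ≤ d) (γ : Fin d → Contour c (g (d + 1)) d)
    (hγ : LinearIndependent ℤ fun k => (γ k).homologyClass) :
    ∃ K : ℂ, K ≠ 0 ∧ ∀ x, (wronskianMatrix γ x).det =
      K * Complex.exp (c * (-(g d / g (d + 1) * x) + if d = 1 then x ^ 2 / (2 * g 2) else 0)) := by
  refine ⟨_, det_wronskianMatrix_zero_ne_zero hd γ hγ, fun x => ?_⟩
  set Θ : ℂ → ℂ := fun x => c * (-(g d / g (d + 1) * x) + if d = 1 then x ^ 2 / (2 * g 2) else 0)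
    with hΘ
  have hΘ' : ∀ x, HasDerivAt Θ (c * (-(g d / g (d + 1)) + if d = 1 then x / g 2 else 0)) x := by
    intro x
    refine HasDerivAt.const_mul c (HasDerivAt.add ?_ ?_)
    · exact (((hasDerivAt_id x).const_mul (g d / g (d + 1))).neg).congr_deriv (by rw [mul_one])
    · split_ifs
      · refine ((hasDerivAt_pow 2 x).div_const (2 * g 2)).congr_deriv ?_
        simp
        rw [mul_div_mul_left _ _ two_ne_zero]
      · exact hasDerivAt_const x 0
  have hF : ∀ x, HasDerivAt (fun z => (wronskianMatrix γ z).det * Complex.exp (-Θ z)) 0 x := by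
    intro x
    refine ((hasDerivAt_det_wronskianMatrix hd γ x).mul (hΘ' x).neg.cexp).congr_deriv ?_
    ring
  have h := is_const_of_deriv_eq_zero (fun x => (hF x).differentiableAt) (fun x => (hF x).deriv) x 0
  have h0 : Θ 0 = 0 := by simp [hΘ]
  rw [h0, neg_zero, Complex.exp_zero, mul_one] at h
  rw [← h, mul_assoc, ← Complex.exp_add, neg_add_cancel, Complex.exp_zero, mul_one]

end Wronskian

/-! ### Absolute convergence of the double integrals. -/

/-- Young's inequality splits the product into squares. One square may keep the small coefficient
`ε`; the large coefficient of `b ^ 2` is absorbed because `b ^ (d₂ + 1)` has higher order. -/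
theorem exists_mul_le_pow_add_pow {d₁ d₂ : ℕ} (hd₁ : 1 ≤ d₁) (hd₂ : 2 ≤ d₂) {M ε : ℝ}
    (hM : 0 < M) (hε : 0 < ε) : ∃ K : ℝ, ∀ a b : ℝ, 0 ≤ a → 0 ≤ b →
      M * (a * b) ≤ ε * a ^ (d₁ + 1) + ε * b ^ (d₂ + 1) + K := by
  -- Chosen so that the factor `M ^ 2 / (4 * ε)` from Young's inequality leaves exactly `ε`.
  obtain ⟨K, hK⟩ := exists_pow_le_mul_pow_add hd₂ (ε := ε * (4 * ε / M ^ 2)) (by positivity)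
  refine ⟨ε + M ^ 2 / (4 * ε) * K, fun a b ha hb => ?_⟩
  have h1 : M * (a * b) ≤ ε * a ^ 2 + M ^ 2 / (4 * ε) * b ^ 2 := by
    have h := sq_nonneg (2 * ε * a - M * b)
    rw [div_mul_eq_mul_div, ← sub_nonneg]
    have : ε * a ^ 2 + M ^ 2 * b ^ 2 / (4 * ε) - M * (a * b) =
        (2 * ε * a - M * b) ^ 2 / (4 * ε) := by
      field_simp
      ring
    rw [this]
    positivity
  have h2 : a ^ 2 ≤ a ^ (d₁ + 1) + 1 := by
    rcases le_total a 1 with h | h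
    · have := pow_le_one₀ (n := 2) ha h
      have : 0 ≤ a ^ (d₁ + 1) := by positivity
      linarith
    · have := pow_le_pow_right₀ h (show 2 ≤ d₁ + 1 by omega)
      linarith
  have h3 : M ^ 2 / (4 * ε) * b ^ 2 ≤
      M ^ 2 / (4 * ε) * (ε * (4 * ε / M ^ 2) * b ^ (d₂ + 1) + K) := by
    gcongr
    exact hK b hb
  have h4 : M ^ 2 / (4 * ε) * (ε * (4 * ε / M ^ 2) * b ^ (d₂ + 1) + K) =
      ε * b ^ (d₂ + 1) + M ^ 2 / (4 * ε) * K := by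
    field_simp
  nlinarith

theorem exists_mul_le_pow_add_pow' {d₁ d₂ : ℕ} (hd₁ : 1 ≤ d₁) (hd₂ : 1 ≤ d₂)
    (hd : ¬(d₁ = 1 ∧ d₂ = 1)) {M ε : ℝ} (hM : 0 < M) (hε : 0 < ε) :
    ∃ K : ℝ, ∀ a b : ℝ, 0 ≤ a → 0 ≤ b →
      M * (a * b) ≤ ε * a ^ (d₁ + 1) + ε * b ^ (d₂ + 1) + K := by
  by_cases h : 2 ≤ d₂
  · exact exists_mul_le_pow_add_pow hd₁ h hM hε
  · obtain ⟨K, hK⟩ := exists_mul_le_pow_add_pow hd₂ (d₂ := d₁) (by omega) hM hε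
    exact ⟨K, fun a b ha hb => by have := hK b a hb ha; linarith [mul_comm a b]⟩

variable {c l₁ l₂ : ℂ} {d₁ d₂ : ℕ}

theorem continuous_pairWeight (V₁ V₂ : ℂ[X]) (γ : Contour c l₁ d₁) (η : Contour c l₂ d₂) :
    Continuous fun p : ℝ × ℝ => Complex.exp (-c * (V₁.eval (γ.path p.1) + V₂.eval (η.path p.2) -
      γ.path p.1 * η.path p.2)) * (deriv γ.path p.1 * deriv η.path p.2) := by
  have h1 := γ.continuous_path
  have h2 := η.continuous_path
  have h3 : Continuous fun t => V₁.eval (γ.path t) := V₁.continuous.comp h1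
  have h4 : Continuous fun t => V₂.eval (η.path t) := V₂.continuous.comp h2
  have h5 := γ.continuous_deriv
  have h6 := η.continuous_deriv
  fun_prop

/-- Unless both potentials are quadratic, the coupling `x y` is of lower order: half of each decay
rate pays for it, and the other half gives integrability. -/
theorem momentsConverge (hd₁ : 1 ≤ d₁) (hd₂ : 1 ≤ d₂) (hd : ¬(d₁ = 1 ∧ d₂ = 1)) {V₁ V₂ : ℂ[X]}
    (hV₁ : HasLead l₁ d₁ V₁) (hV₂ : HasLead l₂ d₂ V₂)
    (Γx : Fin d₁ → Contour c l₁ d₁) (Γy : Fin d₂ → Contour c l₂ d₂) :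
    MomentsConverge V₁ V₂ Γx Γy := by
  intro i j a b
  obtain ⟨δ₁, hδ₁, A₁, hA₁, h₁⟩ := (Γx i).exists_norm_mul_exp_le hV₁ (X ^ a) 0 (by simp)
  obtain ⟨δ₂, hδ₂, A₂, hA₂, h₂⟩ := (Γy j).exists_norm_mul_exp_le hV₂ (X ^ b) 0 (by simp)
  have hc : 0 < ‖c‖ := norm_pos_iff.mpr (Γx i).ne_zero_left
  obtain ⟨K, hK⟩ := exists_mul_le_pow_add_pow' hd₁ hd₂ hd hc
    (ε := min (δ₁ / 2) (δ₂ / 2)) (lt_min (by positivity) (by positivity))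
  have hint := (((Γx i).tame (δ₁ / 2) (by positivity)).mul_prod
    ((Γy j).tame (δ₂ / 2) (by positivity))).const_mul (A₁ * A₂ * Real.exp K)
  refine Integrable.mono' hint ?_ (.of_forall fun p => ?_)
  · have h1 := (Γx i).continuous_path
    have h2 := (Γy j).continuous_path
    simp only [mul_assoc]
    refine (Continuous.mul (by fun_prop) (Continuous.mul (by fun_prop) ?_)).aestronglyMeasurable
    exact continuous_pairWeight V₁ V₂ (Γx i) (Γy j)
  · have e₁ := h₁ p.1
    have e₂ := h₂ p.2
    set x := (Γx i).path p.1
    set y := (Γy j).path p.2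
    simp only [eval_pow, eval_X, eval_zero, norm_zero, Real.exp_zero, mul_one] at e₁ e₂
    have hsplit : Complex.exp (-c * (V₁.eval x + V₂.eval y - x * y)) =
        Complex.exp (-c * V₁.eval x) * Complex.exp (-c * V₂.eval y) * Complex.exp (c * (x * y)) := by
      rw [← Complex.exp_add, ← Complex.exp_add]
      congr 1
      ring
    have e₃ : ‖Complex.exp (c * (x * y))‖ ≤
        Real.exp (δ₁ / 2 * ‖x‖ ^ (d₁ + 1) + δ₂ / 2 * ‖y‖ ^ (d₂ + 1) + K) := by
      refine (norm_exp_le_exp_norm _).trans (Real.exp_le_exp.mpr ?_)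
      rw [norm_mul, norm_mul]
      refine (hK _ _ (norm_nonneg x) (norm_nonneg y)).trans ?_
      gcongr
      · exact min_le_left _ _
      · exact min_le_right _ _
    rw [hsplit]
    simp only [norm_mul]
    calc _ = (‖x ^ a‖ * ‖Complex.exp (-c * V₁.eval x)‖) *
          (‖y ^ b‖ * ‖Complex.exp (-c * V₂.eval y)‖) * ‖Complex.exp (c * (x * y))‖ *
          (‖deriv (Γx i).path p.1‖ * ‖deriv (Γy j).path p.2‖) := by ring
      _ ≤ (A₁ * Real.exp (-δ₁ * ‖x‖ ^ (d₁ + 1))) * (A₂ * Real.exp (-δ₂ * ‖y‖ ^ (d₂ + 1))) *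
          Real.exp (δ₁ / 2 * ‖x‖ ^ (d₁ + 1) + δ₂ / 2 * ‖y‖ ^ (d₂ + 1) + K) *
          (‖deriv (Γx i).path p.1‖ * ‖deriv (Γy j).path p.2‖) := by gcongr
      _ = _ := by
        have h1 : Real.exp (-(δ₁ / 2) * ‖x‖ ^ (d₁ + 1)) =
            Real.exp (-δ₁ * ‖x‖ ^ (d₁ + 1)) * Real.exp (δ₁ / 2 * ‖x‖ ^ (d₁ + 1)) := by
          rw [← Real.exp_add]; congr 1; ring
        have h2 : Real.exp (-(δ₂ / 2) * ‖y‖ ^ (d₂ + 1)) =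
            Real.exp (-δ₂ * ‖y‖ ^ (d₂ + 1)) * Real.exp (δ₂ / 2 * ‖y‖ ^ (d₂ + 1)) := by
          rw [← Real.exp_add]; congr 1; ring
        rw [h1, h2, Real.exp_add, Real.exp_add]
        ring

/-! ### Integrals over a product of two contours. -/

/-- `k` is continuous along the contour and bounded there by a polynomial. -/
def Contour.PolyBounded (γ : Contour c l₁ d₁) (k : ℂ → ℂ) : Prop :=
  Continuous (fun t => k (γ.path t)) ∧ ∃ p : ℂ[X], ∀ t, ‖k (γ.path t)‖ ≤ ‖p.eval (γ.path t)‖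

theorem Contour.polyBounded_eval (γ : Contour c l₁ d₁) (p : ℂ[X]) : γ.PolyBounded fun z => p.eval z :=
  ⟨p.continuous.comp γ.continuous_path, p, fun _ => le_rfl⟩

theorem Contour.PolyBounded.mul {γ : Contour c l₁ d₁} {k k' : ℂ → ℂ} (h : γ.PolyBounded k)
    (h' : γ.PolyBounded k') : γ.PolyBounded fun z => k z * k' z := by
  obtain ⟨hc, p, hp⟩ := h
  obtain ⟨hc', p', hp'⟩ := h'
  refine ⟨hc.mul hc', p * p', fun t => ?_⟩
  rw [eval_mul, norm_mul, norm_mul]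
  exact mul_le_mul (hp t) (hp' t) (norm_nonneg _) (norm_nonneg _)

/-- Half the radius of a ball that misses the path, so that the same lower bound serves all nearby
points when differentiating Cauchy kernels. -/
theorem Contour.exists_pos_le_norm_sub (γ : Contour c l₁ d₁) {x : ℂ} (hx : x ∉ Set.range γ.path) :
    ∃ ρ > 0, ∀ y ∈ Metric.ball x ρ, ∀ t, ρ ≤ ‖y - γ.path t‖ := by
  obtain ⟨ε, hε, h⟩ := Metric.isOpen_iff.mp γ.isClosed_range.isOpen_compl x hx
  refine ⟨ε / 2, by positivity, fun y hy t => ?_⟩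
  by_contra! hlt
  refine h (?_ : γ.path t ∈ Metric.ball x ε) ⟨t, rfl⟩
  rw [mem_ball_iff_norm] at hy ⊢
  calc _ = ‖(y - x) - (y - γ.path t)‖ := by congr 1; ring
    _ ≤ ‖y - x‖ + ‖y - γ.path t‖ := norm_sub_le _ _
    _ < ε := by linarith

theorem Contour.polyBounded_inv (γ : Contour c l₁ d₁) {x : ℂ} (hx : x ∉ Set.range γ.path) :
    γ.PolyBounded fun z => (x - z)⁻¹ := by
  obtain ⟨ρ, hρ, h⟩ := γ.exists_pos_le_norm_sub hx
  refine ⟨?_, C (ρ⁻¹ : ℂ), fun t => ?_⟩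
  · refine (continuous_const.sub γ.continuous_path).inv₀ fun t => sub_ne_zero.mpr ?_
    rintro rfl
    exact hx ⟨t, rfl⟩
  · rw [eval_C, norm_inv, norm_inv, Complex.norm_real, Real.norm_of_nonneg hρ.le]
    gcongr
    exact h x (Metric.mem_ball_self hρ) t

section Pair

variable (V₁ V₂ : ℂ[X]) (γ : Contour c l₁ d₁) (η : Contour c l₂ d₂)

/-- The moments converge absolutely on a product of two contours. -/
def PairConverges : Prop := ∀ a b : ℕ, Integrable fun p : ℝ × ℝ =>
  γ.path p.1 ^ a * η.path p.2 ^ b *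
    Complex.exp (-c * (V₁.eval (γ.path p.1) + V₂.eval (η.path p.2) - γ.path p.1 * η.path p.2)) *
    (deriv γ.path p.1 * deriv η.path p.2)

/-- The integral of `k(x) q(y) exp (-c (V₁(x) + V₂(y) - x y))` over a product of two contours. -/
noncomputable def pairIntegral (k : ℂ → ℂ) (q : ℂ[X]) : ℂ :=
  ∫ p : ℝ × ℝ, k (γ.path p.1) * q.eval (η.path p.2) *
    Complex.exp (-c * (V₁.eval (γ.path p.1) + V₂.eval (η.path p.2) - γ.path p.1 * η.path p.2)) *
    (deriv γ.path p.1 * deriv η.path p.2)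

variable {V₁ V₂ γ η}

theorem integrable_pair (h : PairConverges V₁ V₂ γ η) {k : ℂ → ℂ} (hk : γ.PolyBounded k)
    (q : ℂ[X]) : Integrable fun p : ℝ × ℝ => k (γ.path p.1) * q.eval (η.path p.2) *
      Complex.exp (-c * (V₁.eval (γ.path p.1) + V₂.eval (η.path p.2) - γ.path p.1 * η.path p.2)) *
      (deriv γ.path p.1 * deriv η.path p.2) := by
  obtain ⟨hc, p, hp⟩ := hk
  have h1 : Integrable fun z : ℝ × ℝ => p.eval (γ.path z.1) * q.eval (η.path z.2) *
      Complex.exp (-c * (V₁.eval (γ.path z.1) + V₂.eval (η.path z.2) - γ.path z.1 * η.path z.2)) *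
      (deriv γ.path z.1 * deriv η.path z.2) := by
    have h2 := integrable_finsetSum (Finset.range (p.natDegree + 1) ×ˢ
      Finset.range (q.natDegree + 1)) fun i _ => (h i.1 i.2).const_mul (p.coeff i.1 * q.coeff i.2)
    refine h2.congr (.of_forall fun z => ?_)
    simp only
    rw [eval_eq_sum_range (p := p), eval_eq_sum_range (p := q), Finset.sum_mul_sum, ← Finset.sum_product',
      Finset.sum_mul, Finset.sum_mul]
    exact Finset.sum_congr rfl fun i _ => by ring
  refine h1.mono ?_ (.of_forall fun z => ?_)
  · have h3 : Continuous fun t => q.eval (η.path t) := q.continuous.comp η.continuous_path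
    simp only [mul_assoc]
    refine (Continuous.mul (hc.comp continuous_fst) (Continuous.mul (h3.comp continuous_snd)
      (continuous_pairWeight V₁ V₂ γ η))).aestronglyMeasurable
  · simp only [norm_mul]
    gcongr
    exact hp z.1

theorem exp_pairWeight (V₁ V₂ : ℂ[X]) (c x y : ℂ) :
    Complex.exp (-c * (V₁.eval x + V₂.eval y - x * y)) =
      Complex.exp (-c * V₁.eval x) * Complex.exp (-c * V₂.eval y) * Complex.exp (c * x * y) := by
  rw [← Complex.exp_add, ← Complex.exp_add]
  congr 1
  ring

/-- Fubini: the inner integral is a Fourier-Laplace transform, so integration by parts in `y`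
carries over. -/
theorem pairIntegral_eq (h : PairConverges V₁ V₂ γ η) {k : ℂ → ℂ} (hk : γ.PolyBounded k)
    (q : ℂ[X]) : pairIntegral V₁ V₂ γ η k q = ∫ s, k (γ.path s) *
      Complex.exp (-c * V₁.eval (γ.path s)) * deriv γ.path s *
        η.transform V₂ q (γ.path s) := by
  rw [pairIntegral, Measure.volume_eq_prod, integral_prod _ (integrable_pair h hk q)]
  congr 1 with s
  rw [Contour.transform, Contour.integral, ← MeasureTheory.integral_const_mul]
  congr 1 with t
  rw [exp_pairWeight]
  ring

theorem isLinearMap_pairIntegral (h : PairConverges V₁ V₂ γ η) {k : ℂ → ℂ}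
    (hk : γ.PolyBounded k) : IsLinearMap ℂ (pairIntegral V₁ V₂ γ η k) where
  map_add p q := by
    simp only [pairIntegral]
    rw [← integral_add (integrable_pair h hk p) (integrable_pair h hk q)]
    congr 1 with z
    rw [eval_add]
    ring
  map_smul a q := by
    simp only [pairIntegral]
    rw [smul_eq_mul, ← MeasureTheory.integral_const_mul]
    congr 1 with z
    rw [eval_smul, smul_eq_mul]
    ring

theorem pairIntegral_add_left (h : PairConverges V₁ V₂ γ η) {k k' : ℂ → ℂ}
    (hk : γ.PolyBounded k) (hk' : γ.PolyBounded k') (q : ℂ[X]) :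
    pairIntegral V₁ V₂ γ η (fun z => k z + k' z) q =
      pairIntegral V₁ V₂ γ η k q + pairIntegral V₁ V₂ γ η k' q := by
  simp only [pairIntegral]
  rw [← integral_add (integrable_pair h hk q) (integrable_pair h hk' q)]
  congr 1 with z
  ring

theorem pairIntegral_smul_left (a : ℂ) (k : ℂ → ℂ) (q : ℂ[X]) :
    pairIntegral V₁ V₂ γ η (fun z => a * k z) q = a * pairIntegral V₁ V₂ γ η k q := by
  simp only [pairIntegral]
  rw [← MeasureTheory.integral_const_mul]
  congr 1 with z
  ring

theorem pairIntegral_congr {k k' : ℂ → ℂ} (hk : ∀ s, k (γ.path s) = k' (γ.path s)) (q : ℂ[X]) :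
    pairIntegral V₁ V₂ γ η k q = pairIntegral V₁ V₂ γ η k' q := by
  simp only [pairIntegral, hk]

/-- Integration by parts in the second variable. -/
theorem pairIntegral_derivative_right (hd₂ : 1 ≤ d₂) (hV₂ : HasLead l₂ d₂ V₂)
    (h : PairConverges V₁ V₂ γ η) {k : ℂ → ℂ} (hk : γ.PolyBounded k) (q : ℂ[X]) :
    pairIntegral V₁ V₂ γ η k (derivative V₂ * q - C c⁻¹ * derivative q) =
      pairIntegral V₁ V₂ γ η (fun z => z * k z) q := by
  have hX : γ.PolyBounded fun z => z * k z := by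
    simpa using (γ.polyBounded_eval X).mul hk
  rw [pairIntegral_eq h hk, pairIntegral_eq h hX]
  congr 1 with s
  rw [η.transform_derivative hd₂ hV₂]
  ring

/-- Integration by parts in the first variable. -/
theorem pairIntegral_derivative_left (hd₁ : 1 ≤ d₁) (hV₁ : HasLead l₁ d₁ V₁)
    (h : PairConverges V₁ V₂ γ η) {x : ℂ} (hx : x ∉ Set.range γ.path) (q : ℂ[X]) :
    pairIntegral V₁ V₂ γ η (fun z => (x - z)⁻¹ * (x - z)⁻¹) q =
      c * pairIntegral V₁ V₂ γ η (fun z => (derivative V₁).eval z * (x - z)⁻¹) q -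
        c * pairIntegral V₁ V₂ γ η (fun z => (x - z)⁻¹) (X * q) := by
  have hb := γ.polyBounded_inv hx
  have hne : ∀ s, x - γ.path s ≠ 0 := fun s => by
    rw [sub_ne_zero]
    rintro rfl
    exact hx ⟨s, rfl⟩
  have i1 := integrable_pair h (hb.mul hb) q
  have i2 := (integrable_pair h ((γ.polyBounded_eval (derivative V₁)).mul hb) q).const_mul c
  have i3 := (integrable_pair h hb (X * q)).const_mul c
  rw [← sub_eq_zero]
  simp only [pairIntegral]
  rw [← MeasureTheory.integral_const_mul, ← MeasureTheory.integral_const_mul,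
    ← integral_sub i2 i3]
  refine (integral_sub i1 (i2.sub i3)).symm.trans ?_
  rw [Measure.volume_eq_prod]
  -- With `y` fixed, the combined integrand is a constant times the derivative, along the path, of
  -- `(x - z)⁻¹ exp (-c V₁(z)) exp (c y z)`. This decays at both ends, so the inner integral
  -- vanishes.
  refine (integral_prod_symm _ (i1.sub (i2.sub i3))).trans ?_
  refine (integral_congr_ae (.of_forall fun t => ?_)).trans (integral_zero _ _)
  simp only [Pi.sub_apply]
  set y := η.path t
  obtain ⟨ρ, hρ, hρ'⟩ := γ.exists_pos_le_norm_sub hx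
  obtain ⟨δ, hδ, A, hA, hbound⟩ := γ.exists_transform_bound hd₁ hV₁ 1 ‖y‖
  have hderiv : ∀ s, HasDerivAt (fun s => (x - γ.path s)⁻¹ * ((1 : ℂ[X]).eval (γ.path s) *
      Complex.exp (-c * V₁.eval (γ.path s)) * Complex.exp (c * y * γ.path s)))
      (((x - γ.path s)⁻¹ * (x - γ.path s)⁻¹ + (x - γ.path s)⁻¹ *
        (-c * (derivative V₁).eval (γ.path s) + c * y)) *
        (Complex.exp (-c * V₁.eval (γ.path s)) * Complex.exp (c * y * γ.path s) *
        deriv γ.path s)) s := by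
    intro s
    have h1 := γ.hasDerivAt_weight V₁ 1 y s
    have h2 := ((γ.hasDerivAt s).const_sub x).inv (hne s)
    refine (h2.mul h1).congr_deriv ?_
    simp
    field_simp
  have hlim : ∀ s, ‖(x - γ.path s)⁻¹ * ((1 : ℂ[X]).eval (γ.path s) *
      Complex.exp (-c * V₁.eval (γ.path s)) * Complex.exp (c * y * γ.path s))‖ ≤
      ρ⁻¹ * A * Real.exp (-δ * ‖γ.path s‖ ^ (d₁ + 1)) := by
    intro s
    rw [norm_mul, norm_inv, mul_assoc ρ⁻¹]
    gcongr
    · exact hρ' x (Metric.mem_ball_self hρ) s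
    · exact hbound s y le_rfl
  have hint : Integrable fun s => ((x - γ.path s)⁻¹ * (x - γ.path s)⁻¹ + (x - γ.path s)⁻¹ *
        (-c * (derivative V₁).eval (γ.path s) + c * y)) *
        (Complex.exp (-c * V₁.eval (γ.path s)) * Complex.exp (c * y * γ.path s) *
        deriv γ.path s) := by
    have h1 := (γ.integrable_transform hd₁ hV₁ 1 y).bdd_mul (c := ρ⁻¹ * ρ⁻¹)
      (hb.mul hb).1.aestronglyMeasurable (.of_forall fun s => by
        rw [norm_mul, norm_inv]
        gcongr <;> exact hρ' x (Metric.mem_ball_self hρ) s)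
    have h2 := (γ.integrable_transform hd₁ hV₁ (C (-c) * derivative V₁ + C (c * y)) y).bdd_mul
      (c := ρ⁻¹) hb.1.aestronglyMeasurable (.of_forall fun s => by
        rw [norm_inv]
        gcongr
        exact hρ' x (Metric.mem_ball_self hρ) s)
    refine (h1.add h2).congr (.of_forall fun s => ?_)
    simp only [Pi.add_apply, eval_one, eval_add, eval_mul, eval_C]
    ring
  have h0 := γ.integral_deriv_eq_zero hderiv hint hδ hlim
  have h1 : ∀ K : ℂ, ∫ s, K * (((x - γ.path s)⁻¹ * (x - γ.path s)⁻¹ + (x - γ.path s)⁻¹ *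
        (-c * (derivative V₁).eval (γ.path s) + c * y)) *
        (Complex.exp (-c * V₁.eval (γ.path s)) * Complex.exp (c * y * γ.path s) *
        deriv γ.path s)) = 0 := by
    intro K
    rw [MeasureTheory.integral_const_mul, h0, mul_zero]
  refine Eq.trans ?_ (h1 (q.eval y * Complex.exp (-c * V₂.eval y) * deriv η.path t))
  congr 1 with s
  rw [exp_pairWeight, eval_mul, eval_X, mul_right_comm c y]
  ring

theorem hasDerivAt_pairIntegral (h : PairConverges V₁ V₂ γ η) {x : ℂ}
    (hx : x ∉ Set.range γ.path) (q : ℂ[X]) :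
    HasDerivAt (fun x => pairIntegral V₁ V₂ γ η (fun z => (x - z)⁻¹) q)
      (-pairIntegral V₁ V₂ γ η (fun z => (x - z)⁻¹ * (x - z)⁻¹) q) x := by
  obtain ⟨ρ, hρ, hρ'⟩ := γ.exists_pos_le_norm_sub hx
  have hy : ∀ y ∈ Metric.ball x ρ, y ∉ Set.range γ.path := by
    rintro y hy ⟨t, rfl⟩
    have := hρ' _ hy t
    simp at this
    linarith
  have hone : γ.PolyBounded fun _ => 1 := by simpa using γ.polyBounded_eval 1
  have hdiff : ∀ (p : ℝ × ℝ), ∀ y ∈ Metric.ball x ρ, HasDerivAt (fun y => (y - γ.path p.1)⁻¹ *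
      q.eval (η.path p.2) * Complex.exp (-c * (V₁.eval (γ.path p.1) + V₂.eval (η.path p.2) -
      γ.path p.1 * η.path p.2)) * (deriv γ.path p.1 * deriv η.path p.2))
      (-((y - γ.path p.1)⁻¹ * (y - γ.path p.1)⁻¹ *
      q.eval (η.path p.2) * Complex.exp (-c * (V₁.eval (γ.path p.1) + V₂.eval (η.path p.2) -
      γ.path p.1 * η.path p.2)) * (deriv γ.path p.1 * deriv η.path p.2))) y := by
    intro p y hy'
    have hne : y - γ.path p.1 ≠ 0 := by
      rw [sub_ne_zero]
      rintro rfl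
      exact hy _ hy' ⟨_, rfl⟩
    have h1 := ((hasDerivAt_id y).sub_const (γ.path p.1)).inv hne
    refine (((h1.mul_const (q.eval (η.path p.2))).mul_const _).mul_const _).congr_deriv ?_
    simp only [id]
    field_simp
  have hbound : ∀ (p : ℝ × ℝ), ∀ y ∈ Metric.ball x ρ,
      ‖-((y - γ.path p.1)⁻¹ * (y - γ.path p.1)⁻¹ *
      q.eval (η.path p.2) * Complex.exp (-c * (V₁.eval (γ.path p.1) + V₂.eval (η.path p.2) -
      γ.path p.1 * η.path p.2)) * (deriv γ.path p.1 * deriv η.path p.2))‖ ≤ ρ⁻¹ * ρ⁻¹ *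
      ‖1 * q.eval (η.path p.2) * Complex.exp (-c * (V₁.eval (γ.path p.1) + V₂.eval (η.path p.2) -
      γ.path p.1 * η.path p.2)) * (deriv γ.path p.1 * deriv η.path p.2)‖ := by
    intro p y hy'
    have h1 := hρ' y hy' p.1
    rw [norm_neg, one_mul]
    simp only [norm_mul, norm_inv, ← mul_assoc]
    gcongr
  have h1 := (hasDerivAt_integral_of_dominated_loc_of_deriv_le
    (Metric.ball_mem_nhds x hρ)
    (Filter.eventually_of_mem (Metric.ball_mem_nhds x hρ) fun y hy' =>
      (integrable_pair h (γ.polyBounded_inv (hy y hy')) q).aestronglyMeasurable)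
    (integrable_pair h (γ.polyBounded_inv hx) q)
    (integrable_pair h ((γ.polyBounded_inv hx).mul (γ.polyBounded_inv hx))
      q).neg.aestronglyMeasurable
    (.of_forall hbound) ((integrable_pair h hone q).norm.const_mul _)
    (.of_forall hdiff)).2
  rw [MeasureTheory.integral_neg] at h1
  exact h1

end Pair

theorem natDegree_derivative_le_of_hasLead {lead : ℂ} {d : ℕ} {V : ℂ[X]} (hV : HasLead lead d V) :
    (derivative V).natDegree ≤ d := by
  have h : V.natDegree ≤ d + 1 := by
    have h1 : V = (V - C (lead / (d + 1)) * X ^ (d + 1)) + C (lead / (d + 1)) * X ^ (d + 1) := by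
      ring
    rw [h1]
    exact natDegree_add_le_of_degree_le (hV.trans (by omega)) (natDegree_C_mul_X_pow_le _ _)
  exact (natDegree_derivative_le V).trans (by omega)

/-! ### The bilinear pairing and the Cauchy transform. -/

section Double

variable {c l₁ l₂ : ℂ} {d₁ d₂ : ℕ} (V₁ V₂ : ℂ[X]) (Γx : Fin d₁ → Contour c l₁ d₁)
  (Γy : Fin d₂ → Contour c l₂ d₂) (κ : Matrix (Fin d₁) (Fin d₂) ℂ)

/-- The integral of `k(x) q(y) exp (-c (V₁(x) + V₂(y) - x y))` over `Γ`. -/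
noncomputable def pairing (k : ℂ → ℂ) (q : ℂ[X]) : ℂ :=
  ∑ i, ∑ j, κ i j * pairIntegral V₁ V₂ (Γx i) (Γy j) k q

variable {V₁ V₂ Γx Γy κ}

theorem isLinearMap_pairing (hM : MomentsConverge V₁ V₂ Γx Γy) {k : ℂ → ℂ}
    (hk : ∀ i, (Γx i).PolyBounded k) : IsLinearMap ℂ (pairing V₁ V₂ Γx Γy κ k) where
  map_add p q := by
    simp only [pairing, ← Finset.sum_add_distrib, ← mul_add,
      (isLinearMap_pairIntegral (hM _ _) (hk _)).map_add]
  map_smul a q := by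
    simp only [pairing, smul_eq_mul, Finset.mul_sum, mul_left_comm a,
      (isLinearMap_pairIntegral (hM _ _) (hk _)).map_smul]

theorem pairing_add_left (hM : MomentsConverge V₁ V₂ Γx Γy) {k k' : ℂ → ℂ}
    (hk : ∀ i, (Γx i).PolyBounded k) (hk' : ∀ i, (Γx i).PolyBounded k') (q : ℂ[X]) :
    pairing V₁ V₂ Γx Γy κ (fun z => k z + k' z) q =
      pairing V₁ V₂ Γx Γy κ k q + pairing V₁ V₂ Γx Γy κ k' q := by
  simp only [pairing, ← Finset.sum_add_distrib, ← mul_add,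
    pairIntegral_add_left (hM _ _) (hk _) (hk' _)]

theorem pairing_smul_left (a : ℂ) (k : ℂ → ℂ) (q : ℂ[X]) :
    pairing V₁ V₂ Γx Γy κ (fun z => a * k z) q = a * pairing V₁ V₂ Γx Γy κ k q := by
  simp only [pairing, Finset.mul_sum, mul_left_comm a, pairIntegral_smul_left]

theorem pairing_congr {k k' : ℂ → ℂ} (hk : ∀ i s, k ((Γx i).path s) = k' ((Γx i).path s))
    (q : ℂ[X]) : pairing V₁ V₂ Γx Γy κ k q = pairing V₁ V₂ Γx Γy κ k' q := by
  simp only [pairing, pairIntegral_congr (hk _)]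

theorem isLinearMap_pairing_left (hM : MomentsConverge V₁ V₂ Γx Γy) (q : ℂ[X]) :
    IsLinearMap ℂ fun p : ℂ[X] => pairing V₁ V₂ Γx Γy κ (fun z => p.eval z) q where
  map_add p p' := by
    rw [← pairing_add_left hM (fun i => (Γx i).polyBounded_eval p)
      fun i => (Γx i).polyBounded_eval p']
    simp only [eval_add]
  map_smul a p := by
    rw [smul_eq_mul, ← pairing_smul_left]
    simp only [eval_smul, smul_eq_mul]

theorem pairing_derivative_right (hd₂ : 1 ≤ d₂) (hV₂ : HasLead l₂ d₂ V₂)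
    (hM : MomentsConverge V₁ V₂ Γx Γy) {k : ℂ → ℂ} (hk : ∀ i, (Γx i).PolyBounded k) (q : ℂ[X]) :
    pairing V₁ V₂ Γx Γy κ k (derivative V₂ * q - C c⁻¹ * derivative q) =
      pairing V₁ V₂ Γx Γy κ (fun z => z * k z) q := by
  simp only [pairing, pairIntegral_derivative_right hd₂ hV₂ (hM _ _) (hk _)]

variable (V₁ V₂ Γx Γy κ) in
/-- The Hilbert transform of a polynomial. -/
noncomputable def cauchyTransform (q : ℂ[X]) (x : ℂ) : ℂ :=
  Complex.exp (c * V₁.eval x) * pairing V₁ V₂ Γx Γy κ (fun z => (x - z)⁻¹) q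

theorem isLinearMap_cauchyTransform (hM : MomentsConverge V₁ V₂ Γx Γy) {x : ℂ}
    (hx : ∀ i, x ∉ Set.range (Γx i).path) :
    IsLinearMap ℂ fun q => cauchyTransform V₁ V₂ Γx Γy κ q x := by
  have h := isLinearMap_pairing (κ := κ) hM fun i => (Γx i).polyBounded_inv (hx i)
  constructor
  · intro p q
    simp only [cauchyTransform, h.map_add, mul_add]
  · intro a q
    simp only [cauchyTransform, h.map_smul, smul_eq_mul, mul_left_comm a]

/-- Integration by parts in `y` produces a factor `z`, and `z / (x - z) = x / (x - z) - 1`; the last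
term is the defect. -/
theorem cauchyTransform_derivative (hd₂ : 1 ≤ d₂) (hV₂ : HasLead l₂ d₂ V₂)
    (hM : MomentsConverge V₁ V₂ Γx Γy) {x : ℂ} (hx : ∀ i, x ∉ Set.range (Γx i).path) (q : ℂ[X]) :
    cauchyTransform V₁ V₂ Γx Γy κ (derivative V₂ * q - C c⁻¹ * derivative q) x =
      x * cauchyTransform V₁ V₂ Γx Γy κ q x -
        Complex.exp (c * V₁.eval x) * pairing V₁ V₂ Γx Γy κ (fun _ => 1) q := by
  have hone : ∀ i, (Γx i).PolyBounded fun _ => 1 := fun i => by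
    simpa using (Γx i).polyBounded_eval 1
  have hX : ∀ i, (Γx i).PolyBounded fun z => z * (x - z)⁻¹ := fun i => by
    simpa using ((Γx i).polyBounded_eval X).mul ((Γx i).polyBounded_inv (hx i))
  have h1 : pairing V₁ V₂ Γx Γy κ (fun z => x * (x - z)⁻¹) q =
      pairing V₁ V₂ Γx Γy κ (fun z => z * (x - z)⁻¹ + 1) q := by
    refine pairing_congr (fun i s => ?_) q
    have : x - (Γx i).path s ≠ 0 := sub_ne_zero.mpr fun h => hx i ⟨s, h.symm⟩
    field_simp
    ring
  rw [pairing_smul_left, pairing_add_left hM hX hone] at h1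
  rw [cauchyTransform, cauchyTransform, pairing_derivative_right hd₂ hV₂ hM
    fun i => (Γx i).polyBounded_inv (hx i)]
  linear_combination -(Complex.exp (c * V₁.eval x)) * h1

/-- The squared kernel is integrated by parts in `z`, which produces `V₁'(z) / (x - z)`. Together
with `V₁'(x) / (x - z)` from the prefactor this forms the divided difference of `V₁'`, a polynomial
in `z`: the purpose of the prefactor. -/
theorem hasDerivAt_cauchyTransform (hd₁ : 1 ≤ d₁) (hV₁ : HasLead l₁ d₁ V₁)
    (hM : MomentsConverge V₁ V₂ Γx Γy) {x : ℂ} (hx : ∀ i, x ∉ Set.range (Γx i).path) (q : ℂ[X]) :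
    HasDerivAt (cauchyTransform V₁ V₂ Γx Γy κ q)
      (c * cauchyTransform V₁ V₂ Γx Γy κ (X * q) x + c * Complex.exp (c * V₁.eval x) *
        pairing V₁ V₂ Γx Γy κ (fun z => (derivative V₁ /ₘ (X - C x)).eval z) q) x := by
  have hb : ∀ i, (Γx i).PolyBounded fun z => (x - z)⁻¹ :=
    fun i => (Γx i).polyBounded_inv (hx i)
  have hr : ∀ i, (Γx i).PolyBounded fun z => (derivative V₁ /ₘ (X - C x)).eval z :=
    fun i => (Γx i).polyBounded_eval _
  have h1 : HasDerivAt (fun x => pairing V₁ V₂ Γx Γy κ (fun z => (x - z)⁻¹) q)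
      (-pairing V₁ V₂ Γx Γy κ (fun z => (x - z)⁻¹ * (x - z)⁻¹) q) x := by
    simp only [pairing, ← Finset.sum_neg_distrib, ← mul_neg]
    exact HasDerivAt.fun_sum fun i _ => HasDerivAt.fun_sum fun j _ =>
      (hasDerivAt_pairIntegral (hM i j) (hx i) q).const_mul _
  have h2 : pairing V₁ V₂ Γx Γy κ (fun z => (x - z)⁻¹ * (x - z)⁻¹) q =
      c * pairing V₁ V₂ Γx Γy κ (fun z => (derivative V₁).eval z * (x - z)⁻¹) q -
        c * pairing V₁ V₂ Γx Γy κ (fun z => (x - z)⁻¹) (X * q) := by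
    simp only [pairing, pairIntegral_derivative_left hd₁ hV₁ (hM _ _) (hx _), mul_sub,
      Finset.sum_sub_distrib, Finset.mul_sum, mul_left_comm c]
  have h3 : pairing V₁ V₂ Γx Γy κ (fun z => (derivative V₁).eval x * (x - z)⁻¹) q =
      pairing V₁ V₂ Γx Γy κ (fun z => (derivative V₁).eval z * (x - z)⁻¹ +
        (derivative V₁ /ₘ (X - C x)).eval z) q := by
    refine pairing_congr (fun i s => ?_) q
    have hne : x - (Γx i).path s ≠ 0 := sub_ne_zero.mpr fun h => hx i ⟨s, h.symm⟩
    have h4 := congrArg (eval ((Γx i).path s)) (modByMonic_add_div (derivative V₁) (X - C x))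
    rw [modByMonic_X_sub_C_eq_C_eval] at h4
    simp only [eval_add, eval_mul, eval_sub, eval_X, eval_C] at h4
    field_simp
    linear_combination h4
  rw [pairing_smul_left, pairing_add_left hM
    (fun i => ((Γx i).polyBounded_eval (derivative V₁)).mul (hb i)) hr] at h3
  refine ((((V₁.hasDerivAt x).const_mul c).cexp).mul h1).congr_deriv ?_
  rw [h2, cauchyTransform]
  linear_combination c * Complex.exp (c * V₁.eval x) * h3

end Double

/-! ### Polynomial sequences as bases; multiplication by the variable. -/

section Sequence

/-- The basis of polynomials formed by a sequence. -/
noncomputable abbrev seqBasis (p : Polynomial.Sequence ℂ) : Module.Basis ℕ ℂ ℂ[X] :=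
  p.basis fun i => isUnit_iff_ne_zero.mpr (leadingCoeff_ne_zero.mpr (p.ne_zero i))

theorem seqBasis_repr_eq_zero (p : Polynomial.Sequence ℂ) {q : ℂ[X]} {m l : ℕ}
    (hq : q.natDegree < m) (hl : m ≤ l) : (seqBasis p).repr q l = 0 := by
  have h1 : q ∈ degreeLT ℂ m := by
    rw [mem_degreeLT]
    exact degree_le_natDegree.trans_lt (by exact_mod_cast hq)
  rw [← p.span_degreeLT fun i _ =>
    isUnit_iff_ne_zero.mpr (leadingCoeff_ne_zero.mpr (p.ne_zero i))] at h1
  have h2 : (p : ℕ → ℂ[X]) = seqBasis p := by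
    funext i
    simp
  rw [h2, Module.Basis.mem_span_image] at h1
  by_contra h
  have := h1 (Finsupp.mem_support_iff.mpr h)
  simp at this
  omega

theorem sum_seqBasis_repr (p : Polynomial.Sequence ℂ) {q : ℂ[X]} {m : ℕ} (hq : q.natDegree < m) :
    q = ∑ l ∈ Finset.range m, (seqBasis p).repr q l • p l := by
  conv_lhs => rw [← (seqBasis p).linearCombination_repr q, Finsupp.linearCombination_apply]
  rw [Finsupp.sum_of_support_subset (s := Finset.range m)]
  · simp
  · intro l hl
    by_contra h
    exact Finsupp.mem_support_iff.mp hl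
      (seqBasis_repr_eq_zero p hq (by simpa using h))
  · simp

theorem seqBasis_repr_eq_of_leading (p : Polynomial.Sequence ℂ) (hp : ∀ n, (p n).Monic) {q : ℂ[X]}
    {m : ℕ} (hq : q.natDegree ≤ m) : (seqBasis p).repr q m = q.coeff m := by
  have h := congrArg (fun f : ℂ[X] => f.coeff m) (sum_seqBasis_repr p (Nat.lt_succ_of_le hq))
  simp only [finsetSum_coeff, coeff_smul, smul_eq_mul] at h
  rw [h, Finset.sum_range_succ, Finset.sum_eq_zero, zero_add]
  · have h1 := hp m
    rw [Monic, leadingCoeff, p.natDegree_eq] at h1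
    rw [h1, mul_one]
  · intro l hl
    rw [coeff_eq_zero_of_natDegree_lt (by rw [p.natDegree_eq]; exact Finset.mem_range.mp hl),
      mul_zero]

theorem multMatrix_eq (p : Polynomial.Sequence ℂ) (r : ℕ → ℂ) (n m : ℕ) :
    multMatrix p r n m = r m / r n * (seqBasis p).repr (X * p n) m := rfl

theorem natDegree_X_mul_seq (p : Polynomial.Sequence ℂ) (n : ℕ) :
    (X * p n).natDegree = n + 1 := by
  rw [natDegree_X_mul (p.ne_zero n), p.natDegree_eq]

theorem multMatrix_eq_zero (p : Polynomial.Sequence ℂ) (r : ℕ → ℂ) {n m : ℕ} (h : n + 1 < m) :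
    multMatrix p r n m = 0 := by
  rw [multMatrix_eq, seqBasis_repr_eq_zero p (m := n + 2) (by rw [natDegree_X_mul_seq]; omega) h,
    mul_zero]

theorem multMatrix_succ_ne_zero (p : Polynomial.Sequence ℂ) (hp : ∀ n, (p n).Monic) {r : ℕ → ℂ}
    (hr : ∀ n, r n ≠ 0) (n : ℕ) : multMatrix p r n (n + 1) ≠ 0 := by
  have h1 : (X * p n).coeff (n + 1) = 1 := by
    have h1 := hp n
    rw [Monic, leadingCoeff, p.natDegree_eq] at h1
    rw [coeff_X_mul, h1]
  rw [multMatrix_eq, seqBasis_repr_eq_of_leading p hp (natDegree_X_mul_seq p n).le, h1, mul_one]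
  exact div_ne_zero (hr _) (hr _)

/-- Multiplication by the variable in the normalized sequence, under a linear functional. -/
theorem map_X_mul_div (p : Polynomial.Sequence ℂ) {r : ℕ → ℂ} (hr : ∀ n, r n ≠ 0) {Λ : ℂ[X] → ℂ}
    (hΛ : IsLinearMap ℂ Λ) (n : ℕ) :
    Λ (X * p n) / r n = ∑ l ∈ Finset.range (n + 2), multMatrix p r n l * (Λ (p l) / r l) := by
  have h := congrArg (hΛ.mk' Λ) (sum_seqBasis_repr p (q := X * p n) (m := n + 2)
    (by rw [natDegree_X_mul_seq]; omega))
  rw [map_sum] at h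
  simp only [map_smul, IsLinearMap.mk'_apply, smul_eq_mul] at h
  rw [h, Finset.sum_div]
  refine Finset.sum_congr rfl fun l _ => ?_
  rw [multMatrix_eq]
  have := hr l
  have := hr n
  field_simp

end Sequence

/-! ### Biorthogonality and the string equation. -/

section Biorthogonal

variable {c l₁ l₂ : ℂ} {d₁ d₂ : ℕ} {V₁ V₂ : ℂ[X]} {Γx : Fin d₁ → Contour c l₁ d₁}
  {Γy : Fin d₂ → Contour c l₂ d₂} {κ : Matrix (Fin d₁) (Fin d₂) ℂ} {π σ : Polynomial.Sequence ℂ}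
  {h r : ℕ → ℂ}

theorem IsBiorthogonal.pairing_eq (hbi : IsBiorthogonal V₁ V₂ Γx Γy κ π σ h) (n m : ℕ) :
    pairing V₁ V₂ Γx Γy κ (fun z => (π n).eval z) (σ m) = if n = m then h n else 0 :=
  hbi.2.2 n m

theorem IsBiorthogonal.pairing_left (hbi : IsBiorthogonal V₁ V₂ Γx Γy κ π σ h)
    (hM : MomentsConverge V₁ V₂ Γx Γy) (p : ℂ[X]) (m : ℕ) :
    pairing V₁ V₂ Γx Γy κ (fun z => p.eval z) (σ m) = (seqBasis π).repr p m * h m := by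
  have hlin := isLinearMap_pairing_left (κ := κ) hM (σ m)
  have h1 := congrArg (hlin.mk' _) (sum_seqBasis_repr π (q := p) (m := p.natDegree + m + 1)
    (by omega))
  rw [map_sum] at h1
  simp only [map_smul, IsLinearMap.mk'_apply, smul_eq_mul, hbi.pairing_eq] at h1
  rw [h1, Finset.sum_eq_single m]
  · simp
  · intro b _ hb
    simp [hb]
  · intro hm
    simp at hm

theorem IsBiorthogonal.pairing_right (hbi : IsBiorthogonal V₁ V₂ Γx Γy κ π σ h)
    (hM : MomentsConverge V₁ V₂ Γx Γy) (q : ℂ[X]) (m : ℕ) :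
    pairing V₁ V₂ Γx Γy κ (fun z => (π m).eval z) q = (seqBasis σ).repr q m * h m := by
  have hlin := isLinearMap_pairing (κ := κ) hM fun i => (Γx i).polyBounded_eval (π m)
  have h1 := congrArg (hlin.mk' _) (sum_seqBasis_repr σ (q := q) (m := q.natDegree + m + 1)
    (by omega))
  rw [map_sum] at h1
  simp only [map_smul, IsLinearMap.mk'_apply, smul_eq_mul, hbi.pairing_eq] at h1
  rw [h1, Finset.sum_eq_single m]
  · simp
  · intro b _ hb
    simp [hb.symm]
  · intro hm
    simp at hm

theorem natDegree_string_le (hV₂ : HasLead l₂ d₂ V₂) (σ : Polynomial.Sequence ℂ) (m : ℕ) :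
    (derivative V₂ * σ m - C c⁻¹ * derivative (σ m)).natDegree ≤ m + d₂ := by
  refine (natDegree_sub_le _ _).trans (max_le ?_ ?_)
  · refine natDegree_mul_le.trans ?_
    rw [σ.natDegree_eq]
    have := natDegree_derivative_le_of_hasLead hV₂
    omega
  · refine (natDegree_C_mul_le _ _).trans ((natDegree_derivative_le _).trans ?_)
    rw [σ.natDegree_eq]
    omega

/-- By integration by parts, `q ↦ V₂' q - c⁻¹ q'` is adjoint to multiplication by `x`. Dual bases
therefore give it the transposed matrix, with factors `r` from the normalization. -/
theorem IsBiorthogonal.repr_string (hbi : IsBiorthogonal V₁ V₂ Γx Γy κ π σ h)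
    (hM : MomentsConverge V₁ V₂ Γx Γy) (hd₂ : 1 ≤ d₂) (hV₂ : HasLead l₂ d₂ V₂)
    (hh : ∀ m, h m ≠ 0) (hr : ∀ m, r m ^ 2 = h m) (l m : ℕ) :
    (seqBasis σ).repr (derivative V₂ * σ m - C c⁻¹ * derivative (σ m)) l =
      multMatrix π r l m * (r m / r l) := by
  have hr0 : ∀ m, r m ≠ 0 := fun m hm => hh m (by rw [← hr, hm]; simp)
  have h1 := hbi.pairing_right hM (derivative V₂ * σ m - C c⁻¹ * derivative (σ m)) l
  rw [pairing_derivative_right hd₂ hV₂ hM fun i => (Γx i).polyBounded_eval (π l)] at h1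
  have h2 := hbi.pairing_left hM (X * π l) m
  simp only [eval_mul, eval_X] at h2
  rw [h2, ← hr, ← hr] at h1
  rw [multMatrix_eq]
  have := hr0 l
  have := hr0 m
  generalize (seqBasis σ).repr _ l = b at h1 ⊢
  field_simp
  linear_combination -h1

theorem IsBiorthogonal.map_string (hbi : IsBiorthogonal V₁ V₂ Γx Γy κ π σ h)
    (hM : MomentsConverge V₁ V₂ Γx Γy) (hd₂ : 1 ≤ d₂) (hV₂ : HasLead l₂ d₂ V₂)
    (hh : ∀ m, h m ≠ 0) (hr : ∀ m, r m ^ 2 = h m) {Λ : ℂ[X] → ℂ} (hΛ : IsLinearMap ℂ Λ) (m : ℕ) :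
    Λ (derivative V₂ * σ m - C c⁻¹ * derivative (σ m)) / r m =
      ∑ l ∈ Finset.range (m + d₂ + 1), multMatrix π r l m * (Λ (σ l) / r l) := by
  have hr0 : ∀ m, r m ≠ 0 := fun m hm => hh m (by rw [← hr, hm]; simp)
  have h1 := congrArg (hΛ.mk' Λ) (sum_seqBasis_repr σ (m := m + d₂ + 1)
    (Nat.lt_succ_of_le (natDegree_string_le (c := c) hV₂ σ m)))
  rw [map_sum] at h1
  simp only [map_smul, IsLinearMap.mk'_apply, smul_eq_mul,
    hbi.repr_string hM hd₂ hV₂ hh hr] at h1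
  rw [h1, Finset.sum_div]
  refine Finset.sum_congr rfl fun l _ => ?_
  have := hr0 l
  have := hr0 m
  field_simp

theorem sum_multMatrix_window (π : Polynomial.Sequence ℂ) (r : ℕ → ℂ) (u : ℕ → ℂ) (d m : ℕ) :
    ∑ l ∈ Finset.range (m + 1 + d + 1), multMatrix π r l (m + 1) * u l =
      ∑ i : Fin (d + 2), multMatrix π r (m + i) (m + 1) * u (m + i) := by
  rw [← Finset.sum_range fun i => multMatrix π r (m + i) (m + 1) * u (m + i),
    show m + 1 + d + 1 = m + (d + 2) by ring, Finset.sum_range_add, Finset.sum_eq_zero, zero_add]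
  intro l hl
  rw [multMatrix_eq_zero π r (by have := Finset.mem_range.mp hl; omega), zero_mul]

/-- The outermost entry is, up to normalization, the leading coefficient of `V₂'`. Its nonvanishing
lets the recursion be solved upwards. -/
theorem IsBiorthogonal.multMatrix_add_ne_zero {g : ℕ → ℂ} {Γy : Fin d₂ → Contour c (g (d₂ + 1)) d₂}
    (hbi : IsBiorthogonal V₁ (potential d₂ g) Γx Γy κ π σ h)
    (hM : MomentsConverge V₁ (potential d₂ g) Γx Γy) (hd₂ : 1 ≤ d₂) (hg : g (d₂ + 1) ≠ 0)
    (hh : ∀ m, h m ≠ 0) (hr : ∀ m, r m ^ 2 = h m) (m : ℕ) :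
    multMatrix π r (m + d₂) m ≠ 0 := by
  have h1 := hbi.repr_string hM hd₂ (hasLead_potential d₂ g) hh hr (m + d₂) m
  rw [seqBasis_repr_eq_of_leading σ hbi.2.1
    (natDegree_string_le (hasLead_potential d₂ g) σ m)] at h1
  have h2 : (derivative (potential d₂ g)).coeff d₂ = g (d₂ + 1) := by
    rw [derivative_potential, finsetSum_coeff, Finset.sum_range_succ, Finset.sum_eq_zero]
    · simp
    · intro k hk
      rw [coeff_C_mul_X_pow, if_neg (Finset.mem_range.mp hk).ne']
  have h3 : (derivative (potential d₂ g) * σ m).coeff (m + d₂) = g (d₂ + 1) := by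
    rw [add_comm m, coeff_mul_add_eq_of_natDegree_le
      (natDegree_derivative_le_of_hasLead (hasLead_potential d₂ g)) (σ.natDegree_eq m).le, h2]
    have h4 := hbi.2.1 m
    rw [Monic, leadingCoeff, σ.natDegree_eq] at h4
    rw [h4, mul_one]
  have h4 : (C c⁻¹ * derivative (σ m)).coeff (m + d₂) = 0 := by
    refine coeff_eq_zero_of_natDegree_lt (((natDegree_C_mul_le _ _).trans
      (natDegree_derivative_le _)).trans_lt ?_)
    rw [σ.natDegree_eq]
    omega
  rw [coeff_sub, h3, h4, sub_zero] at h1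
  intro h0
  rw [h0, zero_mul] at h1
  exact hg h1

end Biorthogonal

/-! ### Folding onto a window. -/

section Folding

variable {d : ℕ} {Q : ℕ → ℕ → ℂ}

/-- Evaluation of a row of polynomials at `x`, paired with the window of `u` at `s`. -/
noncomputable def rowEval (x : ℂ) (u : ℕ → ℂ) (s : ℕ) (v : Fin (d + 1) → ℂ[X]) : ℂ :=
  ∑ j, (v j).eval x * u (s + j)

theorem rowEval_recursion (x : ℂ) (u : ℕ → ℂ) (s : ℕ) (a : ℂ) (v : Fin (d + 1) → ℂ[X])
    (b : Fin (d + 1) → ℂ) (w : Fin (d + 1) → Fin (d + 1) → ℂ[X]) :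
    rowEval x u s (a • ((X : ℂ[X]) • v - ∑ i, b i • w i)) =
      a * (x * rowEval x u s v - ∑ i, b i * rowEval x u s (w i)) := by
  simp only [rowEval, Pi.smul_apply, Pi.sub_apply, Finset.sum_apply, eval_smul, eval_sub,
    eval_finsetSum, smul_eq_mul, eval_mul, eval_X, Finset.mul_sum]
  rw [Finset.sum_comm (s := Finset.univ) (t := Finset.univ)
    (f := fun i j => b i * (eval x (w i j) * u (s + j))), ← Finset.sum_sub_distrib, Finset.mul_sum]
  refine Finset.sum_congr rfl fun j _ => ?_
  rw [mul_assoc, sub_mul, Finset.sum_mul]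
  congr 2
  · ring
  · exact Finset.sum_congr rfl fun i _ => by ring

/-- Any solution of the recursion relations is recovered from a window by folding. -/
theorem eq_rowEval_dualFolding (hd : 1 ≤ d) {x : ℂ} {u : ℕ → ℂ} (s : ℕ)
    (hQ : ∀ l, Q l (l + 1) ≠ 0) (hQ' : ∀ m, Q (m + d) m ≠ 0)
    (hrec : ∀ m, x * u (m + 1) = ∑ i : Fin (d + 2), Q (m + i) (m + 1) * u (m + i)) (l : ℕ) :
    u l = rowEval x u s (dualFolding d Q s l) := by
  have hup : ∀ l, s ≤ l → u l = rowEval x u s (dualFolding d Q s l) := by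
    intro l
    induction l using Nat.strong_induction_on with
    | _ l ih =>
      intro hl
      rw [dualFolding, if_neg (by omega)]
      split_ifs with h
      · obtain ⟨m, rfl⟩ : ∃ m, l = m + 1 + d := ⟨l - d - 1, by omega⟩
        rw [rowEval_recursion]
        simp only [Nat.add_sub_cancel]
        rw [← ih (m + 1) (by omega) (by omega)]
        have h1 : ∀ i : Fin (d + 1), rowEval x u s (dualFolding d Q s (m + i)) = u (m + i) :=
          fun i => (ih _ (by omega) (by omega)).symm
        simp only [h1]
        rw [hrec m, Fin.sum_univ_castSucc]
        simp only [Fin.val_castSucc, Fin.val_last, add_sub_cancel_left]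
        rw [show m + (d + 1) = m + 1 + d by ring, inv_mul_cancel_left₀ (hQ' (m + 1))]
      · obtain ⟨j, rfl⟩ := Nat.exists_eq_add_of_le hl
        have hj : j < d + 1 := by omega
        have hof : Fin.ofNat (d + 1) j = ⟨j, hj⟩ := by
          ext
          exact Nat.mod_eq_of_lt hj
        rw [add_tsub_cancel_left, hof, rowEval, Finset.sum_eq_single ⟨j, hj⟩]
        · simp
        · intro i _ hi
          simp [hi]
        · simp
  -- Below the window, induction on the distance to it: the relation with `m = l + 1` involves,
  -- besides `u l`, only larger indices.
  have hdown : ∀ k l, s - l = k → u l = rowEval x u s (dualFolding d Q s l) := by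
    intro k
    induction k using Nat.strong_induction_on with
    | _ k ih =>
      intro l hk
      have ih' : ∀ l', l < l' → u l' = rowEval x u s (dualFolding d Q s l') := by
        intro l' hl'
        by_cases h : s ≤ l'
        · exact hup l' h
        · exact ih (s - l') (by omega) l' rfl
      by_cases hl : s ≤ l
      · exact hup l hl
      rw [dualFolding, if_pos (by omega), rowEval_recursion, ← ih' (l + 1) (by omega)]
      have h1 : ∀ i : Fin (d + 1), rowEval x u s (dualFolding d Q s (l + 1 + i)) = u (l + 1 + i) :=
        fun i => (ih' _ (by omega)).symm
      simp only [h1]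
      rw [hrec l, Fin.sum_univ_succ]
      simp only [Fin.val_zero, add_zero, Fin.val_succ]
      rw [Finset.sum_congr rfl fun i _ => by rw [show l + ((i : ℕ) + 1) = l + 1 + i by ring],
        add_sub_cancel_right, inv_mul_cancel_left₀ (hQ l)]
  exact hdown _ l rfl

end Folding

/-! ### Determinants of windows. -/

section Determinant

variable {d : ℕ} {Q : ℕ → ℕ → ℂ}

theorem det_companion (α : Fin (d + 1) → ℂ) :
    (Matrix.of fun i => Fin.lastCases (motive := fun _ => Fin (d + 1) → ℂ) α
      (fun i' => Pi.single i'.succ 1) i).det = (-1) ^ d * α 0 := by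
  rw [Matrix.det_succ_column_zero, Finset.sum_eq_single (Fin.last d)]
  · have : (Matrix.of fun i => Fin.lastCases (motive := fun _ => Fin (d + 1) → ℂ) α
      (fun i' => Pi.single i'.succ 1) i).submatrix (Fin.last d).succAbove Fin.succ = 1 := by
      ext i j
      simp [Matrix.one_apply, Pi.single_apply, eq_comm]
    rw [this]
    simp
  · intro i _ hi
    obtain ⟨i', rfl⟩ := Fin.exists_castSucc_eq.mpr hi
    simp
  · simp

theorem det_identity_lastRow (β : Fin (d + 1) → ℂ) :
    (Matrix.of fun i => Fin.lastCases (motive := fun _ => Fin (d + 1) → ℂ) β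
      (fun i' => Pi.single i'.castSucc 1) i).det = β (Fin.last d) := by
  rw [Matrix.det_of_isLowerTriangular, Fin.prod_univ_castSucc]
  · simp
  · intro i j hij
    change i < j at hij
    obtain ⟨i', rfl⟩ := Fin.exists_castSucc_eq.mpr (hij.trans_le (Fin.le_last j)).ne
    simp [hij.ne']

/-- The matrix of a window. -/
def windowMatrix (d : ℕ) (u : ℕ → Fin (d + 1) → ℂ) (s : ℕ) : Matrix (Fin (d + 1)) (Fin (d + 1)) ℂ :=
  Matrix.of fun i => u (s + i)

/-- The recursion writes the new last row through the old window, so a companion matrix relates the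
two. Its determinant sees only the coefficient of the dropped row; as `d ≥ 1`, the variable `x`
enters at index `1` and not there, and the factor is free of `x`. -/
theorem det_windowMatrix_succ (hd : 1 ≤ d) {x : ℂ} {u : ℕ → Fin (d + 1) → ℂ} (s : ℕ)
    (hQ' : Q (s + 1 + d) (s + 1) ≠ 0)
    (hrec : ∀ k, x * u (s + 1) k = ∑ i : Fin (d + 2), Q (s + i) (s + 1) * u (s + i) k) :
    (windowMatrix d u (s + 1)).det =
      (-1) ^ d * (-(Q s (s + 1) / Q (s + 1 + d) (s + 1))) * (windowMatrix d u s).det := by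
  set α : Fin (d + 1) → ℂ := fun j => (Q (s + 1 + d) (s + 1))⁻¹ *
    ((if j = ⟨1, by omega⟩ then x else 0) - Q (s + j) (s + 1)) with hα
  have h : windowMatrix d u (s + 1) = (Matrix.of fun i => Fin.lastCases
      (motive := fun _ => Fin (d + 1) → ℂ) α (fun i' => Pi.single i'.succ 1) i) *
      windowMatrix d u s := by
    ext i k
    rw [Matrix.mul_apply]
    induction i using Fin.lastCases with
    | last =>
      have h1 := hrec k
      rw [Fin.sum_univ_castSucc] at h1
      simp only [Fin.val_castSucc, Fin.val_last] at h1
      rw [show s + (d + 1) = s + 1 + d by ring] at h1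
      simp only [windowMatrix, Matrix.of_apply, Fin.val_last, Fin.lastCases_last, hα, mul_assoc,
        sub_mul, ite_mul, zero_mul]
      rw [← Finset.mul_sum, Finset.sum_sub_distrib, Finset.sum_ite_eq']
      simp only [Finset.mem_univ, if_true]
      rw [h1]
      field_simp
      ring
    | cast i =>
      simp [windowMatrix, Pi.single_apply, add_assoc, add_comm 1]
  rw [h, Matrix.det_mul, det_companion]
  have : (0 : Fin (d + 1)) ≠ ⟨1, by omega⟩ := by
    intro h
    simpa using congrArg Fin.val h
  simp only [hα, this, if_false, Fin.val_zero, add_zero]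
  ring

/-- The constant is chosen before `x` and `u`; the global constant in the theorem depends on this
order. -/
theorem exists_det_windowMatrix_eq (hd : 1 ≤ d) (hQ : ∀ l, Q l (l + 1) ≠ 0)
    (hQ' : ∀ m, Q (m + d) m ≠ 0) (s : ℕ) : ∃ a : ℂ, a ≠ 0 ∧ ∀ (x : ℂ) (u : ℕ → Fin (d + 1) → ℂ),
      (∀ m k, x * u (m + 1) k = ∑ i : Fin (d + 2), Q (m + i) (m + 1) * u (m + i) k) →
      (windowMatrix d u s).det = a * (windowMatrix d u 0).det := by
  induction s with
  | zero => exact ⟨1, one_ne_zero, fun x u _ => (one_mul _).symm⟩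
  | succ s ih =>
    obtain ⟨a, ha, h⟩ := ih
    refine ⟨(-1) ^ d * (-(Q s (s + 1) / Q (s + 1 + d) (s + 1))) * a, ?_, fun x u hrec => ?_⟩
    · exact mul_ne_zero (mul_ne_zero (pow_ne_zero _ (by simp))
        (neg_ne_zero.mpr (div_ne_zero (hQ s) (hQ' (s + 1))))) ha
    · rw [det_windowMatrix_succ hd s (hQ' (s + 1)) (hrec s), h x u hrec]
      ring

/-- Replacing the last row by the relation for `m = 0` multiplies the determinant by `Q d 0` and
turns that row into `(-e, 0, …, 0)`; expansion along it removes the Cauchy column. -/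
theorem det_windowMatrix_zero (hd : 1 ≤ d) (hQ' : Q d 0 ≠ 0) {x e : ℂ} {u : ℕ → Fin (d + 1) → ℂ}
    (h0 : ∑ l ∈ Finset.range (d + 1), Q l 0 * u l 0 = x * u 0 0 - e)
    (hk : ∀ k : Fin d, ∑ l ∈ Finset.range (d + 1), Q l 0 * u l k.succ = x * u 0 k.succ) :
    (windowMatrix d u 0).det = (-1) ^ d * (-(e / Q d 0)) *
      (Matrix.of fun i k : Fin d => u i k.succ).det := by
  set β : Fin (d + 1) → ℂ := fun j => Q j 0 - if j = 0 then x else 0 with hβ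
  set B := (Matrix.of fun i => Fin.lastCases (motive := fun _ => Fin (d + 1) → ℂ) β
      (fun i' => Pi.single i'.castSucc 1) i) with hB
  have hlast : ∀ k, (B * windowMatrix d u 0) (Fin.last d) k =
      (∑ l ∈ Finset.range (d + 1), Q l 0 * u l k) - x * u 0 k := by
    intro k
    rw [Matrix.mul_apply, Finset.sum_range]
    simp [hB, hβ, windowMatrix, sub_mul, Finset.sum_sub_distrib]
  have hcast : ∀ (i : Fin d) k, (B * windowMatrix d u 0) i.castSucc k = u i k := by
    intro i k
    rw [Matrix.mul_apply]
    simp [hB, windowMatrix, Pi.single_apply]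
  have hdet : (B * windowMatrix d u 0).det = Q d 0 * (windowMatrix d u 0).det := by
    rw [Matrix.det_mul, det_identity_lastRow]
    have : Fin.last d ≠ 0 := by
      intro h
      have := congrArg Fin.val h
      simp at this
      omega
    simp [hβ, this]
  have hexp : (B * windowMatrix d u 0).det = (-1) ^ d * (-e) *
      (Matrix.of fun i k : Fin d => u i k.succ).det := by
    rw [Matrix.det_succ_row _ (Fin.last d), Finset.sum_eq_single 0]
    · have : (B * windowMatrix d u 0).submatrix (Fin.last d).succAbove (Fin.succAbove 0) =
          Matrix.of fun i k : Fin d => u i k.succ := by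
        ext i k
        rw [Matrix.submatrix_apply, Fin.succAbove_last, Fin.succAbove_zero, hcast, Matrix.of_apply]
      rw [this, hlast, h0]
      simp
    · intro k _ hk0
      obtain ⟨k', rfl⟩ := Fin.exists_succ_eq.mpr hk0
      rw [hlast, hk, sub_self]
      simp
    · simp
  rw [hdet] at hexp
  field_simp
  linear_combination hexp

end Determinant

/-! ### Linear systems with entire coefficients. -/

section LinearODE

variable {ι : Type*} [Fintype ι] {D : ι → ι → ℂ → ℂ}

theorem exists_bound_closedBall (hD : ∀ i j, Differentiable ℂ (D i j)) (x₀ : ℂ) (R : ℝ) :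
    ∃ M : ℝ, 0 ≤ M ∧ ∀ x ∈ Metric.closedBall x₀ R, ∀ i j, ‖D i j x‖ ≤ M := by
  have h : ∀ i j, ∃ M : ℝ, ∀ x ∈ Metric.closedBall x₀ R, ‖D i j x‖ ≤ M := fun i j =>
    (isCompact_closedBall x₀ R).exists_bound_of_continuousOn (hD i j).continuous.continuousOn
  choose M hM using h
  refine ⟨∑ i, ∑ j, |M i j|, by positivity, fun x hx i j => ?_⟩
  calc ‖D i j x‖ ≤ |M i j| := (hM i j x hx).trans (le_abs_self _)
    _ ≤ ∑ j, |M i j| := Finset.single_le_sum (f := fun j => |M i j|)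
        (fun _ _ => abs_nonneg _) (Finset.mem_univ j)
    _ ≤ _ := Finset.single_le_sum (f := fun i => ∑ j, |M i j|)
        (fun _ _ => Finset.sum_nonneg fun _ _ => abs_nonneg _) (Finset.mem_univ i)

theorem norm_sum_mul_le {D' : ι → ℂ} {v : ι → ℂ} {M B : ℝ} (hD : ∀ j, ‖D' j‖ ≤ M) (hM : 0 ≤ M)
    (hv : ∀ j, ‖v j‖ ≤ B) : ‖∑ j, D' j * v j‖ ≤ Fintype.card ι * M * B := by
  refine (norm_sum_le _ _).trans ?_
  calc ∑ j, ‖D' j * v j‖ ≤ ∑ _j : ι, M * B := Finset.sum_le_sum fun j _ => by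
        rw [norm_mul]
        exact mul_le_mul (hD j) (hv j) (norm_nonneg _) hM
    _ = _ := by simp [mul_assoc]

/-- A bound for a function from a bound for its derivative that is a power of the distance. -/
theorem norm_le_of_norm_deriv_le_pow {f f' : ℂ → ℂ} {x₀ : ℂ} {R K : ℝ} {k : ℕ}
    (hf : ∀ x, HasDerivAt f (f' x) x) (h0 : f x₀ = 0)
    (hb : ∀ x ∈ Metric.closedBall x₀ R, ‖f' x‖ ≤ K * ‖x - x₀‖ ^ k) :
    ∀ x ∈ Metric.closedBall x₀ R, ‖f x‖ ≤ K * ‖x - x₀‖ ^ (k + 1) / (k + 1) := by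
  intro x hx
  have hx' : ‖x - x₀‖ ≤ R := by rwa [mem_closedBall_iff_norm] at hx
  have hline : ∀ t : ℝ, HasDerivAt (fun t : ℝ => f (x₀ + t * (x - x₀)))
      (f' (x₀ + t * (x - x₀)) * (x - x₀)) t := by
    intro t
    have h1 : HasDerivAt (fun w : ℂ => x₀ + w * (x - x₀)) (x - x₀) (t : ℂ) := by
      simpa using ((hasDerivAt_id (t : ℂ)).mul_const (x - x₀)).const_add x₀
    exact ((hf _).comp (t : ℂ) h1).comp_ofReal
  have hB : ∀ t : ℝ, HasDerivAt (fun t : ℝ => K * ‖x - x₀‖ ^ (k + 1) / (k + 1) * t ^ (k + 1))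
      (K * ‖x - x₀‖ ^ (k + 1) * t ^ k) t := by
    intro t
    refine ((hasDerivAt_pow (k + 1) t).const_mul _).congr_deriv ?_
    push_cast
    field_simp
  have h := image_norm_le_of_norm_deriv_right_le_deriv_boundary (a := 0) (b := 1)
    (f := fun t : ℝ => f (x₀ + t * (x - x₀)))
    (fun t _ => (hline t).continuousAt.continuousWithinAt)
    (fun t _ => (hline t).hasDerivWithinAt) (by simp [h0]) hB
    (fun t ht => by
      have ht1 : ‖x₀ + t * (x - x₀) - x₀‖ = t * ‖x - x₀‖ := by
        rw [add_sub_cancel_left, norm_mul, Complex.norm_real, Real.norm_of_nonneg ht.1]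
      have h2 := hb (x₀ + t * (x - x₀)) (by
        rw [mem_closedBall_iff_norm, ht1]
        nlinarith [ht.2, norm_nonneg (x - x₀)])
      rw [ht1] at h2
      rw [norm_mul]
      calc _ ≤ K * (t * ‖x - x₀‖) ^ k * ‖x - x₀‖ :=
            mul_le_mul_of_nonneg_right h2 (norm_nonneg _)
        _ = _ := by ring)
    (x := 1) (by simp)
  simpa using h

/-- Linear systems with entire coefficients have entire solutions. -/
theorem exists_entire_solution (hD : ∀ i j, Differentiable ℂ (D i j)) (x₀ : ℂ) (y₀ : ι → ℂ) :
    ∃ f : ι → ℂ → ℂ, (∀ i, f i x₀ = y₀ i) ∧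
      ∀ x i, HasDerivAt (f i) (∑ j, D i j x * f j x) x := by
  have hstep : ∀ g : {g : ι → ℂ → ℂ // ∀ i, Differentiable ℂ (g i)},
      ∃ g' : {g : ι → ℂ → ℂ // ∀ i, Differentiable ℂ (g i)}, (∀ i, g'.1 i x₀ = 0) ∧
        ∀ i x, HasDerivAt (g'.1 i) (∑ j, D i j x * g.1 j x) x := by
    intro g
    have h1 : ∀ i, ∃ G : ℂ → ℂ, G x₀ = 0 ∧ ∀ x, HasDerivAt G (∑ j, D i j x * g.1 j x) x := by
      intro i
      have h2 : Differentiable ℂ fun x => ∑ j, D i j x * g.1 j x :=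
        Differentiable.fun_sum fun j _ => (hD i j).mul (g.2 j)
      obtain ⟨G, hG0, hG⟩ := h2.isExactOn_univ.with_val_at x₀ 0
      exact ⟨G, hG0, fun x => hG x trivial⟩
    choose G hG0 hG using h1
    exact ⟨⟨G, fun i x => (hG i x).differentiableAt⟩, hG0, hG⟩
  choose step hstep0 hstep using hstep
  -- The increments of Picard iteration: each is the primitive, vanishing at `x₀`, of the system
  -- applied to the preceding one. Their sum is the solution.
  let g : ℕ → {g : ι → ℂ → ℂ // ∀ i, Differentiable ℂ (g i)} := fun n =>
    Nat.rec ⟨fun i _ => y₀ i, fun i => differentiable_const _⟩ (fun _ g => step g) n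
  have hg0 : ∀ i x, (g 0).1 i x = y₀ i := fun i x => rfl
  have hgs0 : ∀ n i, (g (n + 1)).1 i x₀ = 0 := fun n i => hstep0 (g n) i
  have hgs : ∀ n i x, HasDerivAt ((g (n + 1)).1 i) (∑ j, D i j x * (g n).1 j x) x :=
    fun n i x => hstep (g n) i x
  set B := ∑ i, ‖y₀ i‖ with hB
  -- Repeated integration of powers of the distance yields the factorials, so the series converges
  -- on every ball.
  have hbound : ∀ R M : ℝ, 0 ≤ M → (∀ x ∈ Metric.closedBall x₀ R, ∀ i j, ‖D i j x‖ ≤ M) →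
      ∀ n, ∀ x ∈ Metric.closedBall x₀ R, ∀ i, ‖(g n).1 i x‖ ≤
        B * (Fintype.card ι * M) ^ n * ‖x - x₀‖ ^ n / n.factorial := by
    intro R M hM0 hM n
    induction n with
    | zero =>
      intro x _ i
      simpa [hg0] using Finset.single_le_sum (f := fun i => ‖y₀ i‖)
        (fun _ _ => norm_nonneg _) (Finset.mem_univ i)
    | succ n ih =>
      intro x hx i
      have h1 := norm_le_of_norm_deriv_le_pow (hgs n i) (hgs0 n i) (R := R) (k := n)
        (K := B * (Fintype.card ι * M) ^ (n + 1) / n.factorial) (fun x hx => by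
          refine (norm_sum_mul_le (hM x hx i) hM0 (ih x hx)).trans (le_of_eq ?_)
          ring) x hx
      refine h1.trans (le_of_eq ?_)
      rw [Nat.factorial_succ]
      push_cast
      field_simp
  have hsum : ∀ K : ℝ, Summable fun n : ℕ => B * (K ^ n / n.factorial) := fun K =>
    (Real.summable_pow_div_factorial K).mul_left B
  have hsummable : ∀ x i, Summable fun n => (g n).1 i x := by
    intro x i
    obtain ⟨M, hM0, hM⟩ := exists_bound_closedBall hD x₀ ‖x - x₀‖
    refine Summable.of_norm_bounded (hsum (Fintype.card ι * M * ‖x - x₀‖)) fun n => ?_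
    refine (hbound _ M hM0 hM n x (by rw [mem_closedBall_iff_norm]) i).trans (le_of_eq ?_)
    rw [mul_pow (Fintype.card ι * M)]
    ring
  refine ⟨fun i x => ∑' n, (g n).1 i x, fun i => ?_, fun x i => ?_⟩
  · refine (tsum_eq_single 0 fun n hn => ?_).trans (hg0 i x₀)
    obtain ⟨m, rfl⟩ := Nat.exists_eq_succ_of_ne_zero hn
    exact hgs0 m i
  · set R := ‖x - x₀‖ + 1
    have hR : 0 < R := by positivity
    obtain ⟨M, hM0, hM⟩ := exists_bound_closedBall hD x₀ R
    have h1 := hasDerivAt_tsum_of_isPreconnected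
      (g := fun n z => (g (n + 1)).1 i z) (g' := fun n z => ∑ j, D i j z * (g n).1 j z)
      (u := fun n => Fintype.card ι * M * (B * ((Fintype.card ι * M * R) ^ n / n.factorial)))
      (t := Metric.ball x₀ R) (y₀ := x₀) (y := x)
      ((hsum _).mul_left _) Metric.isOpen_ball (convex_ball x₀ R).isPreconnected
      (fun n z _ => hgs n i z) (fun n z hz => ?_) (Metric.mem_ball_self hR)
      (by simpa only [hgs0] using summable_zero)
      (by rw [mem_ball_iff_norm]; simp [R])
    · have h2 : (fun z => ∑' n, (g n).1 i z) = fun z => y₀ i + ∑' n, (g (n + 1)).1 i z := by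
        funext z
        rw [(hsummable z i).tsum_eq_zero_add, hg0]
      have h3 : ∑ j, D i j x * ∑' n, (g n).1 j x = ∑' n, ∑ j, D i j x * (g n).1 j x := by
        rw [Summable.tsum_finsetSum fun j _ => (hsummable x j).mul_left _]
        simp only [tsum_mul_left]
      simp only [h2]
      rw [h3]
      exact h1.const_add _
    · have hz' := Metric.ball_subset_closedBall hz
      refine norm_sum_mul_le (hM z hz' i) hM0 fun j => (hbound R M hM0 hM n z hz' j).trans ?_
      rw [mul_pow (Fintype.card ι * M), ← mul_div_assoc, ← mul_assoc]
      rw [mem_ball_iff_norm] at hz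
      have hB0 : 0 ≤ B := by positivity
      gcongr

/-- Local uniqueness for linear systems. -/
theorem eq_zero_of_linear_ode (hD : ∀ i j, Differentiable ℂ (D i j)) {x₀ : ℂ} {R : ℝ}
    {f : ι → ℂ → ℂ} (hf : ∀ x ∈ Metric.ball x₀ R, ∀ i,
      HasDerivAt (f i) (∑ j, D i j x * f j x) x) (h0 : ∀ i, f i x₀ = 0) :
    ∀ x ∈ Metric.ball x₀ R, ∀ i, f i x = 0 := by
  intro x hx i
  obtain ⟨M, hM0, hM⟩ := exists_bound_closedBall hD x₀ R
  have hmem : ∀ t ∈ Set.Icc (0 : ℝ) 1, x₀ + t * (x - x₀) ∈ Metric.ball x₀ R := by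
    intro t ht
    rw [mem_ball_iff_norm] at hx ⊢
    rw [add_sub_cancel_left, norm_mul, Complex.norm_real, Real.norm_of_nonneg ht.1]
    nlinarith [ht.2, norm_nonneg (x - x₀)]
  have hline : ∀ t ∈ Set.Icc (0 : ℝ) 1, HasDerivAt (fun (t : ℝ) i => f i (x₀ + t * (x - x₀)))
      (fun i => (∑ j, D i j (x₀ + t * (x - x₀)) * f j (x₀ + t * (x - x₀))) * (x - x₀)) t := by
    intro t ht
    rw [hasDerivAt_pi]
    intro i
    have h1 : HasDerivAt (fun w : ℂ => x₀ + w * (x - x₀)) (x - x₀) (t : ℂ) := by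
      simpa using ((hasDerivAt_id (t : ℂ)).mul_const (x - x₀)).const_add x₀
    exact ((hf _ (hmem t ht) i).comp (t : ℂ) h1).comp_ofReal
  have h := norm_le_gronwallBound_of_norm_deriv_right_le (a := 0) (b := 1) (δ := 0) (ε := 0)
    (K := Fintype.card ι * M * ‖x - x₀‖)
    (fun t ht => (hline t ht).continuousAt.continuousWithinAt)
    (fun t ht => (hline t (Set.Ico_subset_Icc_self ht)).hasDerivWithinAt)
    (by
      have : (fun i => f i (x₀ + ((0 : ℝ) : ℂ) * (x - x₀))) = 0 := by
        funext i
        simp [h0]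
      rw [this, norm_zero])
    (fun t ht => by
      rw [add_zero, pi_norm_le_iff_of_nonneg (by positivity)]
      intro i
      rw [norm_mul]
      have h2 := norm_sum_mul_le (hM _ (Metric.ball_subset_closedBall
        (hmem t (Set.Ico_subset_Icc_self ht))) i) hM0
        (norm_le_pi_norm fun i => f i (x₀ + t * (x - x₀)))
      calc _ ≤ _ := mul_le_mul_of_nonneg_right h2 (norm_nonneg _)
        _ = _ := by ring)
    1 (by simp)
  rw [gronwallBound_ε0_δ0] at h
  have h3 := congrFun (norm_le_zero_iff.mp h) i
  simpa using h3

end LinearODE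

/-! ### The columns of the dual window: recursion and derivative. -/

section Window

variable {c l₁ l₂ : ℂ} {d₁ d₂ : ℕ} {V₁ V₂ : ℂ[X]} {Γx : Fin d₁ → Contour c l₁ d₁}
  {Γy : Fin d₂ → Contour c l₂ d₂} {κ : Matrix (Fin d₁) (Fin d₂) ℂ} {π σ : Polynomial.Sequence ℂ}
  {h r : ℕ → ℂ}

theorem fourier_eq (γ : Contour c l₂ d₂) (V₂ : ℂ[X]) (σ : Polynomial.Sequence ℂ) (r : ℕ → ℂ)
    (n : ℕ) (x : ℂ) : fourier γ V₂ σ r n x = γ.transform V₂ (σ n) x / r n := by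
  simp only [fourier, Contour.transform, Contour.integral]
  rw [div_eq_mul_inv, ← MeasureTheory.integral_mul_const]
  congr 1 with t
  rw [waveFun]
  ring

theorem hilbert_eq (Γx : Fin d₁ → Contour c l₁ d₁) (Γy : Fin d₂ → Contour c l₂ d₂)
    (κ : Matrix (Fin d₁) (Fin d₂) ℂ) (V₁ V₂ : ℂ[X]) (σ : Polynomial.Sequence ℂ) (r : ℕ → ℂ)
    (n : ℕ) (x : ℂ) : hilbert Γx Γy κ V₁ V₂ σ r n x =
      cauchyTransform V₁ V₂ Γx Γy κ (σ n) x / r n := by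
  simp only [hilbert, cauchyTransform, doubleIntegral, pairing, pairIntegral]
  rw [mul_div_assoc, Finset.sum_div]
  congr 1
  refine Finset.sum_congr rfl fun i _ => ?_
  rw [Finset.sum_div]
  refine Finset.sum_congr rfl fun j _ => ?_
  rw [mul_div_assoc, div_eq_mul_inv, ← MeasureTheory.integral_mul_const]
  congr 2 with p
  rw [waveFun, exp_pairWeight]
  ring

variable (V₁ V₂ Γx Γy κ) in
/-- The linear functionals behind the columns of the dual window. -/
noncomputable def column (x : ℂ) : Fin (d₂ + 1) → ℂ[X] → ℂ :=
  Fin.cons (fun q => cauchyTransform V₁ V₂ Γx Γy κ q x) fun k q => (Γy k).transform V₂ q x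

variable (V₁ V₂ Γx Γy κ σ r) in
/-- The rows of the dual windows. -/
noncomputable def columnSeq (x : ℂ) (l : ℕ) (k : Fin (d₂ + 1)) : ℂ :=
  column V₁ V₂ Γx Γy κ x k (σ l) / r l

theorem columnSeq_zero (x : ℂ) (l : ℕ) :
    columnSeq V₁ V₂ Γx Γy κ σ r x l 0 = hilbert Γx Γy κ V₁ V₂ σ r l x :=
  (hilbert_eq _ _ _ _ _ _ _ _ _).symm

theorem columnSeq_succ (x : ℂ) (l : ℕ) (k : Fin d₂) :
    columnSeq V₁ V₂ Γx Γy κ σ r x l k.succ = fourier (Γy k) V₂ σ r l x :=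
  (fourier_eq _ _ _ _ _ _).symm

theorem dualWindow_eq (n : ℕ) (x : ℂ) : dualWindow Γx Γy κ V₁ V₂ σ r n x =
    windowMatrix d₂ (columnSeq V₁ V₂ Γx Γy κ σ r x) (n - 1) := by
  ext i k
  cases k using Fin.cases with
  | zero => simp [dualWindow, windowMatrix, columnSeq_zero]
  | succ k => simp [dualWindow, windowMatrix, columnSeq_succ]

/-- Only the Cauchy column must avoid the contours. Conditioning the hypothesis on `k = 0` keeps the
other columns available on the whole plane. -/
theorem isLinearMap_column (hd₂ : 1 ≤ d₂) (hV₂ : HasLead l₂ d₂ V₂)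
    (hM : MomentsConverge V₁ V₂ Γx Γy) {x : ℂ} {k : Fin (d₂ + 1)}
    (hx : k = 0 → ∀ i, x ∉ Set.range (Γx i).path) :
    IsLinearMap ℂ (column V₁ V₂ Γx Γy κ x k) := by
  cases k using Fin.cases with
  | zero => exact isLinearMap_cauchyTransform hM (hx rfl)
  | succ k => exact (Γy k).isLinearMap_transform hd₂ hV₂ x

theorem IsBiorthogonal.pairing_eq_zero (hbi : IsBiorthogonal V₁ V₂ Γx Γy κ π σ h)
    (hM : MomentsConverge V₁ V₂ Γx Γy) {p : ℂ[X]} {m : ℕ} (hp : p.natDegree < m) :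
    pairing V₁ V₂ Γx Γy κ (fun z => p.eval z) (σ m) = 0 := by
  rw [hbi.pairing_left hM, seqBasis_repr_eq_zero π hp le_rfl, zero_mul]

/-- The divided difference of `V₁'` has degree less than `d₁ ≤ m`, so its pairing with `σ m`
vanishes and differentiation is just multiplication by `c y`. -/
theorem hasDerivAt_columnSeq (hbi : IsBiorthogonal V₁ V₂ Γx Γy κ π σ h)
    (hM : MomentsConverge V₁ V₂ Γx Γy) (hd₁ : 1 ≤ d₁) (hd₂ : 1 ≤ d₂) (hV₁ : HasLead l₁ d₁ V₁)
    (hV₂ : HasLead l₂ d₂ V₂) (hr0 : ∀ m, r m ≠ 0) {m : ℕ} (hm : d₁ ≤ m) {x : ℂ}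
    {k : Fin (d₂ + 1)} (hx : k = 0 → ∀ i, x ∉ Set.range (Γx i).path) :
    HasDerivAt (fun z => columnSeq V₁ V₂ Γx Γy κ σ r z m k)
      (c * ∑ l ∈ Finset.range (m + 2), multMatrix σ r m l *
        columnSeq V₁ V₂ Γx Γy κ σ r x l k) x := by
  have h1 := map_X_mul_div σ hr0 (isLinearMap_column (κ := κ) hd₂ hV₂ hM hx) m
  simp only [columnSeq]
  rw [← h1, ← mul_div_assoc]
  refine HasDerivAt.div_const ?_ _
  cases k using Fin.cases with
  | zero =>
    have h2 := hasDerivAt_cauchyTransform (κ := κ) hd₁ hV₁ hM (hx rfl) (σ m)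
    rw [hbi.pairing_eq_zero hM, mul_zero, add_zero] at h2
    · exact h2
    · rw [natDegree_divByMonic _ (monic_X_sub_C x), natDegree_X_sub_C]
      have := natDegree_derivative_le_of_hasLead hV₁
      omega
  | succ k => exact (Γy k).hasDerivAt_transform hd₂ hV₂ (σ m) x

/-- The string equation under each column functional. The defect of the Cauchy transform is the
pairing of `1 = π 0` with `σ m`, which is `h 0 = r 0 ^ 2` at `m = 0` and zero otherwise. -/
theorem columnSeq_recursion (hbi : IsBiorthogonal V₁ V₂ Γx Γy κ π σ h)
    (hM : MomentsConverge V₁ V₂ Γx Γy) (hd₂ : 1 ≤ d₂) (hV₂ : HasLead l₂ d₂ V₂)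
    (hh : ∀ m, h m ≠ 0) (hr : ∀ m, r m ^ 2 = h m) {x : ℂ} {k : Fin (d₂ + 1)}
    (hx : k = 0 → ∀ i, x ∉ Set.range (Γx i).path) (m : ℕ) :
    ∑ l ∈ Finset.range (m + d₂ + 1), multMatrix π r l m * columnSeq V₁ V₂ Γx Γy κ σ r x l k =
      x * columnSeq V₁ V₂ Γx Γy κ σ r x m k -
        if k = 0 ∧ m = 0 then Complex.exp (c * V₁.eval x) * r 0 else 0 := by
  have hr0 : ∀ m, r m ≠ 0 := fun m hm => hh m (by rw [← hr, hm]; simp)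
  simp only [columnSeq]
  rw [← hbi.map_string hM hd₂ hV₂ hh hr (isLinearMap_column (κ := κ) hd₂ hV₂ hM hx) m]
  cases k using Fin.cases with
  | zero =>
    change cauchyTransform V₁ V₂ Γx Γy κ _ x / r m = x * (cauchyTransform V₁ V₂ Γx Γy κ _ x / r m) - _
    rw [cauchyTransform_derivative hd₂ hV₂ hM (hx rfl)]
    have h1 : pairing V₁ V₂ Γx Γy κ (fun _ => 1) (σ m) = if m = 0 then r 0 ^ 2 else 0 := by
      split_ifs with hm
      · subst hm
        have h2 : (π 0) = 1 := by
          have := hbi.1 0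
          exact this.natDegree_eq_zero.mp (π.natDegree_eq 0)
        have h3 := hbi.pairing_eq 0 0
        simpa [h2, hr] using h3
      · have := hbi.pairing_eq_zero hM (p := 1) (m := m) (by simp; omega)
        simpa using this
    rw [h1]
    by_cases hm : m = 0
    · subst hm
      have := hr0 0
      simp
      field_simp
    · simp [hm, mul_div_assoc]
  | succ k =>
    change (Γy k).transform V₂ _ x / r m = x * ((Γy k).transform V₂ _ x / r m) - _
    rw [(Γy k).transform_derivative hd₂ hV₂, if_neg (by simp), sub_zero, mul_div_assoc]

theorem columnSeq_recursion_window (hbi : IsBiorthogonal V₁ V₂ Γx Γy κ π σ h)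
    (hM : MomentsConverge V₁ V₂ Γx Γy) (hd₂ : 1 ≤ d₂) (hV₂ : HasLead l₂ d₂ V₂)
    (hh : ∀ m, h m ≠ 0) (hr : ∀ m, r m ^ 2 = h m) {x : ℂ} {k : Fin (d₂ + 1)}
    (hx : k = 0 → ∀ i, x ∉ Set.range (Γx i).path) (m : ℕ) :
    x * columnSeq V₁ V₂ Γx Γy κ σ r x (m + 1) k = ∑ i : Fin (d₂ + 2),
      multMatrix π r (m + i) (m + 1) * columnSeq V₁ V₂ Γx Γy κ σ r x (m + i) k := by
  rw [← sum_multMatrix_window π r (fun l => columnSeq V₁ V₂ Γx Γy κ σ r x l k),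
    columnSeq_recursion hbi hM hd₂ hV₂ hh hr hx, if_neg (by simp), sub_zero]

theorem sum_multMatrix_eq_dualSystem {d : ℕ} {Q : ℕ → ℕ → ℂ} (P : ℕ → ℕ → ℂ) (hd : 1 ≤ d) {x : ℂ}
    {u : ℕ → ℂ} (n : ℕ) (hQ : ∀ l, Q l (l + 1) ≠ 0) (hQ' : ∀ m, Q (m + d) m ≠ 0)
    (hrec : ∀ m, x * u (m + 1) = ∑ i : Fin (d + 2), Q (m + i) (m + 1) * u (m + i))
    (i : Fin (d + 1)) : ∑ l ∈ Finset.range (n - 1 + i + 2), P (n - 1 + i) l * u l =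
      ∑ j, (dualSystem d P Q n i j).eval x * u (n - 1 + j) := by
  rw [Finset.sum_congr rfl fun l _ => by rw [eq_rowEval_dualFolding hd (n - 1) hQ hQ' hrec l]]
  simp only [dualSystem, Matrix.of_apply, eval_finsetSum, eval_mul, eval_C, rowEval,
    Finset.mul_sum, Finset.sum_mul]
  rw [Finset.sum_comm]
  simp only [mul_assoc]

end Window

/-! ### The determinant of the dual window and its differential system. -/

section Final

variable {c l₁ : ℂ} {d₁ d₂ : ℕ} {V₁ : ℂ[X]} {g : ℕ → ℂ} {Γx : Fin d₁ → Contour c l₁ d₁}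
  {Γy : Fin d₂ → Contour c (g (d₂ + 1)) d₂} {κ : Matrix (Fin d₁) (Fin d₂) ℂ}
  {π σ : Polynomial.Sequence ℂ} {h r : ℕ → ℂ}

/-- The determinant of the first Fourier-Laplace transforms is a multiple of the Wronskian. -/
theorem det_transform_seq (hd₂ : 1 ≤ d₂) (Γy : Fin d₂ → Contour c (g (d₂ + 1)) d₂)
    (σ : Polynomial.Sequence ℂ) (hσ : ∀ n, (σ n).Monic) (r : ℕ → ℂ) (x : ℂ) :
    (Matrix.of fun i k : Fin d₂ => (Γy k).transform (potential d₂ g) (σ i) x / r i).det =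
      (∏ i : Fin d₂, (r i)⁻¹) * (wronskianMatrix Γy x).det := by
  -- The passage from monomials to the monic `σ i` is triangular with unit diagonal, apart from the
  -- normalization.
  have h1 : (Matrix.of fun i k : Fin d₂ => (Γy k).transform (potential d₂ g) (σ i) x / r i) =
      (Matrix.of fun i j : Fin d₂ => (σ i).coeff j / r i) * wronskianMatrix Γy x := by
    ext i k
    have hlin := (Γy k).isLinearMap_transform hd₂ (hasLead_potential d₂ g) x
    have h2 := congrArg (hlin.mk' _) ((σ i).as_sum_range' d₂ (by rw [σ.natDegree_eq]; exact i.2))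
    rw [map_sum, Finset.sum_range] at h2
    rw [Matrix.mul_apply]
    simp only [Matrix.of_apply, wronskianMatrix]
    simp only [← smul_X_eq_monomial, map_smul, IsLinearMap.mk'_apply] at h2
    rw [h2, Finset.sum_div]
    refine Finset.sum_congr rfl fun j _ => ?_
    simp only [smul_eq_mul]
    ring
  rw [h1, Matrix.det_mul, Matrix.det_of_isLowerTriangular]
  · congr 1
    refine Finset.prod_congr rfl fun i _ => ?_
    have h2 := hσ i
    rw [Monic, leadingCoeff, σ.natDegree_eq] at h2
    rw [Matrix.of_apply, h2, one_div]
  · intro i j hij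
    change i < j at hij
    rw [Matrix.of_apply, coeff_eq_zero_of_natDegree_lt (by rw [σ.natDegree_eq]; exact hij),
      zero_div]

/-- Descent to the lowest window, removal of the Cauchy column, and the closed form of the
Wronskian. Each step is pointwise in `x` or valid on all of `ℂ`, so no component of the complement
is singled out. -/
theorem exists_det_dualWindow_eq (hbi : IsBiorthogonal V₁ (potential d₂ g) Γx Γy κ π σ h)
    (hM : MomentsConverge V₁ (potential d₂ g) Γx Γy) (hd₂ : 1 ≤ d₂)
    (hΓy : LinearIndependent ℤ fun j => (Γy j).homologyClass)
    (hh : ∀ m, h m ≠ 0) (hr : ∀ m, r m ^ 2 = h m) (n : ℕ) :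
    ∃ K : ℂ, K ≠ 0 ∧ ∀ x, (∀ i, x ∉ Set.range (Γx i).path) →
      (dualWindow Γx Γy κ V₁ (potential d₂ g) σ r n x).det =
        K * Complex.exp (c * (V₁.eval x - g d₂ / g (d₂ + 1) * x +
          if d₂ = 1 then x ^ 2 / (2 * g 2) else 0)) := by
  have hr0 : ∀ m, r m ≠ 0 := fun m hm => hh m (by rw [← hr, hm]; simp)
  have hg : g (d₂ + 1) ≠ 0 := (Γy ⟨0, hd₂⟩).ne_zero_right
  have hQ := multMatrix_succ_ne_zero π hbi.1 hr0
  have hQ' := hbi.multMatrix_add_ne_zero hM hd₂ hg hh hr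
  have hV₂ := hasLead_potential d₂ g
  obtain ⟨a, ha, hdet⟩ := exists_det_windowMatrix_eq hd₂ hQ hQ' (n - 1)
  obtain ⟨K, hK, hW⟩ := exists_det_wronskianMatrix_eq hd₂ Γy hΓy
  have hQ0 : multMatrix π r d₂ 0 ≠ 0 := by simpa using hQ' 0
  refine ⟨a * ((-1) ^ d₂ * (-(r 0 / multMatrix π r d₂ 0)) * ((∏ i : Fin d₂, (r i)⁻¹) * K)),
    ?_, fun x hx => ?_⟩
  · refine mul_ne_zero ha (mul_ne_zero (mul_ne_zero (pow_ne_zero _ (by simp))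
      (neg_ne_zero.mpr (div_ne_zero (hr0 0) hQ0))) (mul_ne_zero ?_ hK))
    exact Finset.prod_ne_zero_iff.mpr fun i _ => inv_ne_zero (hr0 i)
  · have hrec := fun k : Fin (d₂ + 1) => columnSeq_recursion (κ := κ) (k := k) hbi hM hd₂ hV₂ hh hr
      (fun _ => hx) 0
    rw [dualWindow_eq, hdet x _ fun m k =>
      columnSeq_recursion_window hbi hM hd₂ hV₂ hh hr (fun _ => hx) m,
      det_windowMatrix_zero hd₂ hQ0 (e := Complex.exp (c * V₁.eval x) * r 0)
        (by simpa using hrec 0) (fun k => by simpa using hrec k.succ)]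
    have h1 : (Matrix.of fun i k : Fin d₂ =>
        columnSeq V₁ (potential d₂ g) Γx Γy κ σ r x i k.succ) =
        Matrix.of fun i k : Fin d₂ => (Γy k).transform (potential d₂ g) (σ i) x / r i := rfl
    rw [h1, det_transform_seq hd₂ Γy σ hbi.2.1, hW]
    have h2 : c * (V₁.eval x - g d₂ / g (d₂ + 1) * x +
        if d₂ = 1 then x ^ 2 / (2 * g 2) else 0) = c * V₁.eval x +
        c * (-(g d₂ / g (d₂ + 1) * x) + if d₂ = 1 then x ^ 2 / (2 * g 2) else 0) := by ring
    rw [h2, Complex.exp_add]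
    ring

/-- The columns of the dual window satisfy the dual system. -/
theorem hasDerivAt_dualWindow (hbi : IsBiorthogonal V₁ (potential d₂ g) Γx Γy κ π σ h)
    (hM : MomentsConverge V₁ (potential d₂ g) Γx Γy) (hd₁ : 1 ≤ d₁) (hd₂ : 1 ≤ d₂)
    (hV₁ : HasLead l₁ d₁ V₁) (hh : ∀ m, h m ≠ 0) (hr : ∀ m, r m ^ 2 = h m) {n : ℕ} (hn : d₁ < n)
    {x : ℂ} (i k : Fin (d₂ + 1)) (hx : k = 0 → ∀ i, x ∉ Set.range (Γx i).path) :
    HasDerivAt (fun z => dualWindow Γx Γy κ V₁ (potential d₂ g) σ r n z i k)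
      (c * ∑ j, (dualSystem d₂ (multMatrix σ r) (multMatrix π r) n i j).eval x *
        dualWindow Γx Γy κ V₁ (potential d₂ g) σ r n x j k) x := by
  have hr0 : ∀ m, r m ≠ 0 := fun m hm => hh m (by rw [← hr, hm]; simp)
  have hg : g (d₂ + 1) ≠ 0 := (Γy ⟨0, hd₂⟩).ne_zero_right
  have hV₂ := hasLead_potential d₂ g
  simp only [dualWindow_eq, windowMatrix, Matrix.of_apply]
  rw [← sum_multMatrix_eq_dualSystem (u := fun l => columnSeq V₁ (potential d₂ g) Γx Γy κ σ r x l k)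
    (multMatrix σ r) hd₂ n (multMatrix_succ_ne_zero π hbi.1 hr0)
    (hbi.multMatrix_add_ne_zero hM hd₂ hg hh hr)
    (columnSeq_recursion_window hbi hM hd₂ hV₂ hh hr hx) i]
  -- From `d₁ < n` the lowest index `n - 1` of the window is at least `d₁`, so no row has an error
  -- term.
  exact hasDerivAt_columnSeq hbi hM hd₁ hd₂ hV₁ hV₂ hr0 (by omega) hx

end Final

end TwoMatrix

/-! ### The theorem. -/

theorem mainTheorem6
    (d₁ d₂ N : ℕ) (hd₁ : 1 ≤ d₁) (hd₂ : 1 ≤ d₂) (hN : 0 < N)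
    (T : ℂ) (hT : T ≠ 0)
    (g gt : ℕ → ℂ) (hg : g (d₁ + 1) ≠ 0) (hgt : gt (d₂ + 1) ≠ 0)
    (Γx : Fin d₁ → Contour (N / T) (g (d₁ + 1)) d₁)
    (Γy : Fin d₂ → Contour (N / T) (gt (d₂ + 1)) d₂)
    (hΓx : LinearIndependent ℤ fun i => (Γx i).homologyClass)
    (hΓy : LinearIndependent ℤ fun j => (Γy j).homologyClass)
    (κ : Matrix (Fin d₁) (Fin d₂) ℂ)
    (hconv : d₁ = 1 → d₂ = 1 →
      MomentsConverge (potential d₁ g) (potential d₂ gt) Γx Γy)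
    (π σ : Polynomial.Sequence ℂ) (h r : ℕ → ℂ)
    (hbi : IsBiorthogonal (potential d₁ g) (potential d₂ gt) Γx Γy κ π σ h)
    (hh : ∀ m, h m ≠ 0) (hr : ∀ m, r m ^ 2 = h m)
    (n : ℕ) (hn : d₁ < n) :
    ∃ C : ℂ, C ≠ 0 ∧
      (IsFundamentalSolution (T / N) (dualSystem d₂ (multMatrix σ r) (multMatrix π r) n)
          (⋃ i, Set.range (Γx i).path)ᶜ
          (dualWindow Γx Γy κ (potential d₁ g) (potential d₂ gt) σ r n) ∧
        ∀ x ∈ (⋃ i, Set.range (Γx i).path)ᶜ,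
          (dualWindow Γx Γy κ (potential d₁ g) (potential d₂ gt) σ r n x).det =
            C * Complex.exp (N / T * ((potential d₁ g).eval x - gt d₂ / gt (d₂ + 1) * x +
              if d₂ = 1 then x ^ 2 / (2 * gt 2) else 0))) ∧
      ∀ x₀ ∈ (⋃ i, Set.range (Γx i).path)ᶜ,
        ∃ f : ℂ → Fin (d₂ + 1) → ℂ,
          Differentiable ℂ f ∧
          (∀ x ∈ connectedComponentIn (⋃ i, Set.range (Γx i).path)ᶜ x₀, ∀ i,
            f x i = hilbert Γx Γy κ (potential d₁ g) (potential d₂ gt) σ r (n - 1 + i) x) ∧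
          IsFundamentalSolution (T / N)
            (dualSystem d₂ (multMatrix σ r) (multMatrix π r) n) Set.univ
            (fun x => (dualWindow Γx Γy κ (potential d₁ g) (potential d₂ gt) σ r n x).updateCol
              0 (f x)) ∧
          ∀ x : ℂ,
            ((dualWindow Γx Γy κ (potential d₁ g) (potential d₂ gt) σ r n x).updateCol
              0 (f x)).det =
            C * Complex.exp (N / T * ((potential d₁ g).eval x - gt d₂ / gt (d₂ + 1) * x +
              if d₂ = 1 then x ^ 2 / (2 * gt 2) else 0)) := by
  have hM : MomentsConverge (potential d₁ g) (potential d₂ gt) Γx Γy := by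
    by_cases hd : d₁ = 1 ∧ d₂ = 1
    · exact hconv hd.1 hd.2
    · exact momentsConverge hd₁ hd₂ hd (hasLead_potential d₁ g) (hasLead_potential d₂ gt) Γx Γy
  have hN0 : (N : ℂ) ≠ 0 := by exact_mod_cast hN.ne'
  have hTN : ∀ S : ℂ, T / N * (N / T * S) = S := fun S => by field_simp
  set Ω := (⋃ i, Set.range (Γx i).path)ᶜ with hΩ
  set D := dualSystem d₂ (multMatrix σ r) (multMatrix π r) n
  set Φ := dualWindow Γx Γy κ (potential d₁ g) (potential d₂ gt) σ r n
  have hmem : ∀ x ∈ Ω, ∀ i, x ∉ Set.range (Γx i).path := by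
    intro x hx i hi
    exact hx (Set.mem_iUnion.mpr ⟨i, hi⟩)
  have hopen : IsOpen Ω :=
    (isClosed_iUnion_of_finite fun i => (Γx i).isClosed_range).isOpen_compl
  have hder := fun (x : ℂ) (i k : Fin (d₂ + 1))
    (hx : k = 0 → ∀ i, x ∉ Set.range (Γx i).path) =>
    hasDerivAt_dualWindow hbi hM hd₁ hd₂ (hasLead_potential d₁ g) hh hr hn i k hx
  have hsys : ∀ (x : ℂ) (M : Matrix (Fin (d₂ + 1)) (Fin (d₂ + 1)) ℂ) (i k : Fin (d₂ + 1)),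
      (D.map (Polynomial.eval x) * M) i k = ∑ j, (D i j).eval x * M j k := fun x M i k => by
    simp [Matrix.mul_apply]
  obtain ⟨K, hK, hdet⟩ := exists_det_dualWindow_eq hbi hM hd₂ hΓy hh hr n
  set E : ℂ → ℂ := fun x => K * Complex.exp (N / T * ((potential d₁ g).eval x -
    gt d₂ / gt (d₂ + 1) * x + if d₂ = 1 then x ^ 2 / (2 * gt 2) else 0)) with hE
  have hE0 : ∀ x, E x ≠ 0 := fun x => mul_ne_zero hK (Complex.exp_ne_zero _)
  refine ⟨K, hK, ⟨fun x hx => ⟨fun i k => ?_, ?_⟩, fun x hx => hdet x (hmem x hx)⟩, fun x₀ hx₀ => ?_⟩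
  · have h1 := hder x i k fun _ => hmem x hx
    refine ⟨h1.differentiableAt, ?_⟩
    rw [h1.deriv, hTN, hsys]
  · rw [hdet x (hmem x hx)]
    exact hE0 x
  -- The entire column is the solution of the system with the value of the Hilbert column at `x₀`.
  · obtain ⟨f, hf0, hf⟩ := exists_entire_solution
      (D := fun i j x => (N / T : ℂ) * (D i j).eval x)
      (fun i j => (differentiable_const _).mul (D i j).differentiable) x₀ fun i => Φ x₀ i 0
    have hfΦ : ∀ x ∈ Ω, ∀ i, HasDerivAt (fun z => f i z - Φ z i 0)
        (∑ j, (N / T : ℂ) * (D i j).eval x * (f j x - Φ x j 0)) x := by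
      intro x hx i
      refine ((hf x i).sub (hder x i 0 fun _ => hmem x hx)).congr_deriv ?_
      rw [Finset.mul_sum, ← Finset.sum_sub_distrib]
      exact Finset.sum_congr rfl fun j _ => by ring
    have hA : IsOpen (connectedComponentIn Ω x₀) := hopen.connectedComponentIn
    have hAsub : connectedComponentIn Ω x₀ ⊆ Ω := connectedComponentIn_subset Ω x₀
    have hx₀A : x₀ ∈ connectedComponentIn Ω x₀ := mem_connectedComponentIn hx₀
    -- Local uniqueness gives equality on a ball around `x₀`; the identity theorem spreads it over
    -- the component.
    have hagree : ∀ x ∈ connectedComponentIn Ω x₀, ∀ i, f i x = Φ x i 0 := by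
      intro x hx i
      obtain ⟨R, hR, hball⟩ := Metric.isOpen_iff.mp hopen x₀ hx₀
      have hlocal := eq_zero_of_linear_ode (f := fun i z => f i z - Φ z i 0)
        (D := fun i j x => (N / T : ℂ) * (D i j).eval x)
        (fun i j => (differentiable_const _).mul (D i j).differentiable)
        (fun z hz => hfΦ z (hball hz)) fun i => by rw [hf0, sub_self]
      have han : AnalyticOnNhd ℂ (fun z => f i z - Φ z i 0) (connectedComponentIn Ω x₀) :=
        DifferentiableOn.analyticOnNhd
          (fun z hz => (hfΦ z (hAsub hz) i).differentiableAt.differentiableWithinAt) hA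
      exact sub_eq_zero.mp (han.eqOn_zero_of_preconnected_of_eventuallyEq_zero
        isPreconnected_connectedComponentIn hx₀A
        (Filter.eventually_of_mem (Metric.ball_mem_nhds x₀ hR) fun z hz => hlocal z hz i) hx)
    have hentry : ∀ x i k, HasDerivAt (fun z => (Φ z).updateCol 0 (fun i => f i z) i k)
        ((N / T : ℂ) * ∑ j, (D i j).eval x * (Φ x).updateCol 0 (fun i => f i x) j k) x := by
      intro x i k
      cases k using Fin.cases with
      | zero =>
        simp only [Matrix.updateCol_self]
        refine (hf x i).congr_deriv ?_
        rw [Finset.mul_sum]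
        exact Finset.sum_congr rfl fun j _ => by ring
      | succ k =>
        have hk : k.succ ≠ 0 := Fin.succ_ne_zero k
        simp only [Matrix.updateCol_ne hk]
        exact hder x i k.succ fun h0 => absurd h0 hk
    -- Both sides are entire and agree on the component, a nonempty open set.
    have hdetE : ∀ x, ((Φ x).updateCol 0 fun i => f i x).det = E x := by
      have h1 : AnalyticOnNhd ℂ (fun x => ((Φ x).updateCol 0 fun i => f i x).det) Set.univ :=
        DifferentiableOn.analyticOnNhd (fun x _ =>
          (hasDerivAt_det (hentry x)).differentiableAt.differentiableWithinAt) isOpen_univ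
      have h2 : AnalyticOnNhd ℂ E Set.univ := by
        refine DifferentiableOn.analyticOnNhd (Differentiable.differentiableOn ?_) isOpen_univ
        have h3 := (potential d₁ g).differentiable
        rw [hE]
        split_ifs <;> fun_prop
      have h4 := h1.eq_of_eventuallyEq h2 (z₀ := x₀)
        (Filter.eventually_of_mem (hA.mem_nhds hx₀A) fun x hx => by
          have h5 : (Φ x).updateCol 0 (fun i => f i x) = Φ x := by
            ext i k
            cases k using Fin.cases with
            | zero => rw [Matrix.updateCol_self, hagree x hx]
            | succ k => rw [Matrix.updateCol_ne (Fin.succ_ne_zero k)]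
          exact (congrArg Matrix.det h5).trans (hdet x (hmem x (hAsub hx))))
      exact fun x => congrFun h4 x
    refine ⟨fun x i => f i x, differentiable_pi.mpr fun i x => (hf x i).differentiableAt,
      fun x hx i => (hagree x hx i).trans rfl, fun x _ => ⟨fun i k => ?_, ?_⟩, hdetE⟩
    · refine ⟨(hentry x i k).differentiableAt, ?_⟩
      rw [(hentry x i k).deriv, hTN, hsys]
    · rw [hdetE]
      exact hE0 x
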